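/- Let $x_1,\dots,x_n\in\mathbb{R}^d$ be data points that all lie in an $r$-dimensional linear subspace of $\mathbb{R}^d$, and let $(x_{i_t},x_{j_t},x_{k_t})$, $t=1,\dots,N$, be triplets of data points. Put $$A_t=(x_{i_t}-x_{k_t})(x_{i_t}-x_{k_t})^\top-(x_{i_t}-x_{j_t})(x_{i_t}-x_{j_t})^\top .$$ Let $\ell:\mathbb{R}\to\mathbb{R}$ be convex (not necessarily smooth; for example the hinge loss), let $\ell_*(a)=\sup_{u\in\mathbb{R}}(au-\ell(u))\in(-\infty,+\infty]$ be its convex conjugate, and let $\lambda>0$. Write $\langle A,B\rangle=\operatorname{tr}(A^\top B)$, let $\|\cdot\|_F$ be the Frobenius norm, and let $\Pi_{\mathrm{PSD}}$ be the projection onto the cone of positive semidefinite matrices in Frobenius norm. Let $M_*$ be the minimizer of $$\frac{\lambda}{2}\|M\|_F^2+\frac1N\sum_{t=1}^N\ell(\langle M,A_t\rangle)$$ over the symmetric matrices $M\in\mathbb{R}^{d\times d}$. Let $R\in\mathbb{R}^{d\times m}$ be a random matrix with independent entries $R_{a,b}\sim\mathcal{N}(0,1/m)$, put $\widehat G_{a,b}=\langle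 R^\top A_aR,\,R^\top A_bR\rangle$, let $\widehat\alpha\in\mathbb{R}^N$ be an optimal solution of the projected dual problem $$\max_{\alpha\in\mathbb{R}^N}\; -\sum_{t=1}^N\ell_*(\alpha_t)-\frac{1}{2\lambda N}\alpha^\top\widehat G\alpha ,$$ and let $\widehat M=-\frac{1}{\lambda N}\sum_{t=1}^N\widehat\alpha_tA_t$. There is an absolute constant $c\ge 1/3$ such that, for all such data and all $0<\varepsilon\le 1/6$ and $0<\delta<1$: if $$m\ \ge\ \frac{(r+1)\log(2r/\delta)}{c\,\varepsilon^2},$$ then, with probability at least $1-\delta$ over $R$, every optimal solution $\widehat\alpha$ of the projected dual problem satisfies $$\|\Pi_{\mathrm{PSD}}(M_*)-\Pi_{\mathrm{PSD}}(\widehat M)\|_F\ \le\ \frac{3\varepsilon}{1-3\varepsilon}\,\|M_*\|_F .$$ -/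

import Mathlib

open MeasureTheory ProbabilityTheory Matrix
open scoped NNReal ENNReal Matrix.Norms.Frobenius

namespace DualRP

/-! Throughout, `‖M‖` on matrices is the Frobenius norm. -/

/-- The inner product `⟨A, B⟩ = tr (Aᵀ B) = ∑ᵢⱼ Aᵢⱼ Bᵢⱼ` of real matrices. -/
noncomputable def matInner {p q : ℕ} (A B : Matrix (Fin p) (Fin q) ℝ) : ℝ :=
  (Aᵀ * B).trace

/-- The matrix `(x - z)(x - z)ᵀ - (x - y)(x - y)ᵀ` of the triplet `(x, y, z)`, in which `x` should
be more similar to `y` than to `z`. -/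
def tripletMatrix {d : ℕ} (x y z : Fin d → ℝ) : Matrix (Fin d) (Fin d) ℝ :=
  vecMulVec (x - z) (x - z) - vecMulVec (x - y) (x - y)

/-- The primal objective `(lam / 2) ‖M‖_F² + (1 / N) ∑ₜ ℓ ⟨M, A t⟩`. -/
noncomputable def primalObjective {d N : ℕ} (ℓ : ℝ → ℝ) (lam : ℝ)
    (A : Fin N → Matrix (Fin d) (Fin d) ℝ) (M : Matrix (Fin d) (Fin d) ℝ) : ℝ :=
  lam / 2 * ‖M‖ ^ 2 + 1 / (N : ℝ) * ∑ t, ℓ (matInner M (A t))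

/-- `M` minimizes the primal objective over the symmetric matrices. -/
def IsPrimalOptimal {d N : ℕ} (ℓ : ℝ → ℝ) (lam : ℝ)
    (A : Fin N → Matrix (Fin d) (Fin d) ℝ) (M : Matrix (Fin d) (Fin d) ℝ) : Prop :=
  M.IsSymm ∧ ∀ M' : Matrix (Fin d) (Fin d) ℝ, M'.IsSymm →
    primalObjective ℓ lam A M ≤ primalObjective ℓ lam A M'

/-- The convex conjugate `ℓ_* a = sup_u (a u - ℓ u)`, with values in the extended reals. -/
noncomputable def convexConj (ℓ : ℝ → ℝ) (a : ℝ) : EReal :=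
  ⨆ u : ℝ, ((a * u - ℓ u : ℝ) : EReal)

/-- The Gram matrix `⟨A a, A b⟩` of a family of matrices. -/
noncomputable def gram {p N : ℕ} (A : Fin N → Matrix (Fin p) (Fin p) ℝ) :
    Matrix (Fin N) (Fin N) ℝ :=
  Matrix.of fun a b => matInner (A a) (A b)

/-- The dual objective `-∑ₜ ℓ_* (α t) - (1 / (2 lam N)) αᵀ G α`, an extended real (it is `⊥`
where some `ℓ_* (α t)` is infinite). -/
noncomputable def dualObjective {N : ℕ} (ℓ : ℝ → ℝ) (lam : ℝ) (G : Matrix (Fin N) (Fin N) ℝ)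
    (α : Fin N → ℝ) : EReal :=
  -(∑ t, convexConj ℓ (α t)) - ((1 / (2 * lam * N) * (α ⬝ᵥ (G *ᵥ α)) : ℝ) : EReal)

/-- `α` maximizes the dual objective over `ℝ^N`. -/
def IsDualOptimal {N : ℕ} (ℓ : ℝ → ℝ) (lam : ℝ) (G : Matrix (Fin N) (Fin N) ℝ)
    (α : Fin N → ℝ) : Prop :=
  ∀ β : Fin N → ℝ, dualObjective ℓ lam G β ≤ dualObjective ℓ lam G α

/-- The matrices `Rᵀ (A t) R`: the triplet matrices of the projected data points `Rᵀ x`. -/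
def projected {d m N : ℕ} (R : Matrix (Fin d) (Fin m) ℝ)
    (A : Fin N → Matrix (Fin d) (Fin d) ℝ) : Fin N → Matrix (Fin m) (Fin m) ℝ :=
  fun t => Rᵀ * A t * R

/-- The metric `-(1 / (lam N)) ∑ₜ α t • A t` recovered from dual variables. -/
noncomputable def recoveredMetric {d N : ℕ} (lam : ℝ)
    (A : Fin N → Matrix (Fin d) (Fin d) ℝ) (α : Fin N → ℝ) : Matrix (Fin d) (Fin d) ℝ :=
  -((1 / (lam * N)) • ∑ t, α t • A t)

/-- `P` is a point of the positive semidefinite cone at minimal Frobenius distance from `M`. -/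
def IsPSDProjection {d : ℕ} (M P : Matrix (Fin d) (Fin d) ℝ) : Prop :=
  P.PosSemidef ∧ ∀ Q : Matrix (Fin d) (Fin d) ℝ, Q.PosSemidef → ‖M - P‖ ≤ ‖M - Q‖

theorem isClosed_posSemidef (d : ℕ) :
    IsClosed {P : Matrix (Fin d) (Fin d) ℝ | P.PosSemidef} := by
  have h : {P : Matrix (Fin d) (Fin d) ℝ | P.PosSemidef} =
      {P | Pᵀ = P} ∩ ⋂ x : Fin d → ℝ, {P | 0 ≤ x ⬝ᵥ (P *ᵥ x)} := by
    ext P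
    simp only [Set.mem_ofPred_eq, posSemidef_iff_dotProduct_mulVec, Set.mem_inter_iff,
      Set.mem_iInter, star_trivial, IsHermitian, conjTranspose_eq_transpose_of_trivial]
  rw [h]
  refine IsClosed.inter (isClosed_eq (by fun_prop) continuous_id)
    (isClosed_iInter fun x => isClosed_le continuous_const ?_)
  exact Continuous.dotProduct continuous_const (Continuous.matrix_mulVec continuous_id
    continuous_const)

theorem exists_isPSDProjection {d : ℕ} (M : Matrix (Fin d) (Fin d) ℝ) :
    ∃ P, IsPSDProjection M P := by
  have : ProperSpace (Matrix (Fin d) (Fin d) ℝ) := FiniteDimensional.proper ℝ _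
  obtain ⟨P, hP, hd⟩ := (isClosed_posSemidef d).exists_infDist_eq_dist
    ⟨0, Matrix.PosSemidef.zero⟩ M
  refine ⟨P, hP, fun Q hQ => ?_⟩
  rw [← dist_eq_norm, ← dist_eq_norm, ← hd]
  exact Metric.infDist_le_dist_of_mem hQ

/-- The projection `Π_PSD M` of `M` onto the positive semidefinite cone in Frobenius norm. -/
noncomputable def psdProj {d : ℕ} (M : Matrix (Fin d) (Fin d) ℝ) : Matrix (Fin d) (Fin d) ℝ :=
  Classical.choose (exists_isPSDProjection M)

/-- A random `d × m` matrix with independent entries of law `N(0, 1/m)`. -/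
def IsGaussianProjection {Ω : Type*} [MeasurableSpace Ω] (P : Measure Ω) {d m : ℕ}
    (R : Ω → Matrix (Fin d) (Fin m) ℝ) : Prop :=
  (∀ i j, HasLaw (fun ω => R ω i j) (gaussianReal 0 ((m : ℝ≥0)⁻¹)) P) ∧
    iIndepFun (fun (p : Fin d × Fin m) ω => R ω p.1 p.2) P

end DualRP

/-!
The proof has a deterministic and a probabilistic half.

*Deterministic half.* Let `S = R Rᵀ`, let `M̂` be the recovered metric, and put
`u t = ⟨S M̂ S, A t⟩`. The Gram matrix of the projected problem is `⟨A a, S (A b) S⟩`, so dual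
optimality says that `α̂ t` is a subgradient of the loss at `u t` (`IsDualOptimal.sum_le`). These
`u t` are the margins of the symmetric matrix `S M̂ S`, which can therefore be used as a competitor
in the first-order condition for the primal minimizer (`IsPrimalOptimal.variational`). Adding the
two inequalities gives `⟨M̂ - M, S M̂ S - M⟩ ≤ 0`, without strong duality and without smoothness
of the loss. Both `M` and `M̂` live on the subspace spanned by the data. If `U` has an orthonormal
basis of that subspace as columns and `h` are the eigenvalues of `H = Uᵀ S U`, then `B ↦ S B S`
multiplies entries in an eigenbasis by `h a * h b`. Once these products are within `3ε` of `1`, the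
inequality yields `‖M̂ - M‖ ≤ 3ε / (1 - 3ε) ‖M‖` (`norm_sub_recoveredMetric_le`), and the projection
onto the positive semidefinite cone is nonexpansive (`norm_psdProj_sub_le`).

*Probabilistic half.* The eigenvalues of `H` have to lie in `(1 - 3ε/2, 1 + ε)`. This is obtained
from trace moments. Gaussian integration by parts (`integral_trace_mul_compression`), combined with
Chebyshev's sum inequality `tr Hⁱ tr Hʲ ≤ r tr Hⁱ⁺ʲ`, gives the recursions
`E tr Hᵏ⁺¹ ≤ (1 + k (r + 1) / m) E tr Hᵏ` and, for the resolvent `X = (H + τ)⁻¹`,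
`(1 - (p + 1) (r + 1) / m) E tr Xᵖ⁺¹ ≤ E tr Xᵖ`.
With `μ = m / (r + 1)`, Markov's inequality for the powers of order `⌈ε μ⌉`, with `τ = ε / 4`,
bounds the probability of each of the two bad events by `δ / 2`
(`one_sub_le_measure_goodSet`).
-/

namespace DualRP

/-! ### Optimality conditions for the primal and the dual problem -/

theorem exists_subgradient {ℓ : ℝ → ℝ} (hℓ : ConvexOn ℝ Set.univ ℓ) (u : ℝ) :
    ∃ b : ℝ, ∀ v, ℓ u + b * (v - u) ≤ ℓ v := by
  have hu : u ∈ interior (Set.univ : Set ℝ) := by simp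
  refine ⟨derivWithin ℓ (Set.Ioi u) u, fun v => ?_⟩
  rcases lt_trichotomy u v with h | h | h
  · have := hℓ.rightDeriv_le_slope_of_mem_interior hu (Set.mem_univ v) h
    rw [slope_def_field, le_div_iff₀ (by linarith)] at this
    linarith
  · simp [h]
  · have := (hℓ.slope_le_leftDeriv_of_mem_interior (Set.mem_univ v) hu h).trans
      (hℓ.leftDeriv_le_rightDeriv_of_mem_interior hu)
    rw [slope_def_field, div_le_iff₀ (by linarith)] at this
    linarith

theorem convexConj_le_coe_iff {ℓ : ℝ → ℝ} {a c : ℝ} :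
    convexConj ℓ a ≤ c ↔ ∀ u, a * u - ℓ u ≤ c := by
  simp only [convexConj, iSup_le_iff, EReal.coe_le_coe_iff]

theorem convexConj_ne_bot (ℓ : ℝ → ℝ) (a : ℝ) : convexConj ℓ a ≠ ⊥ := by
  have h : ((a * 0 - ℓ 0 : ℝ) : EReal) ≤ convexConj ℓ a :=
    le_iSup (fun u : ℝ => ((a * u - ℓ u : ℝ) : EReal)) 0
  exact fun hb => EReal.coe_ne_bot _ (le_bot_iff.1 (hb ▸ h))

theorem coe_sum_ereal {ι : Type*} (s : Finset ι) (f : ι → ℝ) :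
    ((∑ t ∈ s, f t : ℝ) : EReal) = ∑ t ∈ s, (f t : EReal) := by
  classical
  induction s using Finset.induction_on with
  | empty => simp
  | insert a s ha ih => rw [Finset.sum_insert ha, Finset.sum_insert ha, EReal.coe_add, ih]

theorem coe_le_dualObjective {N : ℕ} {ℓ : ℝ → ℝ} {lam : ℝ} {G : Matrix (Fin N) (Fin N) ℝ}
    {α c : Fin N → ℝ} (h : ∀ t, convexConj ℓ (α t) ≤ c t) :
    ((-(∑ t, c t) - 1 / (2 * lam * N) * (α ⬝ᵥ (G *ᵥ α)) : ℝ) : EReal)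
      ≤ dualObjective ℓ lam G α := by
  rw [dualObjective, EReal.coe_sub, EReal.coe_neg, coe_sum_ereal]
  exact EReal.sub_le_sub (EReal.neg_le_neg_iff.2 (Finset.sum_le_sum fun t _ => h t)) le_rfl

theorem dualObjective_eq_coe {N : ℕ} {ℓ : ℝ → ℝ} {lam : ℝ} {G : Matrix (Fin N) (Fin N) ℝ}
    {α c : Fin N → ℝ} (h : ∀ t, convexConj ℓ (α t) = c t) :
    dualObjective ℓ lam G α
      = ((-(∑ t, c t) - 1 / (2 * lam * N) * (α ⬝ᵥ (G *ᵥ α)) : ℝ) : EReal) := by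
  rw [dualObjective, EReal.coe_sub, EReal.coe_neg, coe_sum_ereal]
  simp only [h]

/-- At a dual optimum all conjugates are finite: otherwise the objective is `⊥` there, although a
subgradient of `ℓ` provides a point of finite value. -/
theorem IsDualOptimal.exists_convexConj_eq {N : ℕ} {ℓ : ℝ → ℝ} (hℓ : ConvexOn ℝ Set.univ ℓ)
    {lam : ℝ} {G : Matrix (Fin N) (Fin N) ℝ} {α : Fin N → ℝ} (hα : IsDualOptimal ℓ lam G α) :
    ∃ c : Fin N → ℝ, ∀ t, convexConj ℓ (α t) = c t := by
  suffices h : ∀ t, convexConj ℓ (α t) ≠ ⊤ from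
    ⟨fun t => (convexConj ℓ (α t)).toReal,
      fun t => (EReal.coe_toReal (h t) (convexConj_ne_bot ℓ _)).symm⟩
  intro t ht
  obtain ⟨b, hb⟩ := exists_subgradient hℓ 0
  have hle := (coe_le_dualObjective (lam := lam) (G := G) (α := fun _ : Fin N => b)
    (c := fun _ => -ℓ 0) fun _ => convexConj_le_coe_iff.2 fun u => by
      have := hb u
      linarith).trans (hα _)
  have hsum : ∑ s, convexConj ℓ (α s) = ⊤ := by
    rw [← Finset.add_sum_erase _ _ (Finset.mem_univ t), ht]
    refine EReal.top_add_of_ne_bot ?_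
    refine Finset.sum_induction _ (fun y : EReal => y ≠ ⊥) (fun a b ha hb => ?_) (by simp)
      (fun s _ => convexConj_ne_bot ℓ _)
    simp [EReal.add_eq_bot_iff, ha, hb]
  rw [dualObjective, hsum, EReal.neg_top, EReal.bot_sub] at hle
  exact EReal.coe_ne_bot _ (le_bot_iff.1 hle)

/-- First-order condition: the linear coefficient of a quadratic that is nonnegative on `(0, 1]` and
vanishes at `0` is nonnegative. -/
theorem nonneg_of_forall_small {a b : ℝ} (h : ∀ s : ℝ, 0 < s → s ≤ 1 → 0 ≤ s * a + s ^ 2 * b) :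
    0 ≤ a := by
  by_contra! ha
  have hb : 0 < b := by nlinarith [h 1 one_pos le_rfl]
  have hs : 0 < min 1 (-a / (2 * b)) := lt_min one_pos (by apply div_pos <;> linarith)
  have h1 := h _ hs (min_le_left _ _)
  have h2 : min 1 (-a / (2 * b)) * b ≤ -a / 2 := by
    calc _ ≤ (-a / (2 * b)) * b := by gcongr; exact min_le_right _ _
      _ = -a / 2 := by field_simp
  nlinarith

/-- If `α` is dual optimal and `u = -(1 / (lam N)) G α`, then `α t` is a subgradient of `ℓ` at
`u t`; here this is stated after summation over `t`. It follows by comparing `α` with the points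
of the segment towards subgradients of `ℓ` at the points `u t`. -/
theorem IsDualOptimal.sum_le {N : ℕ} {ℓ : ℝ → ℝ} (hℓ : ConvexOn ℝ Set.univ ℓ)
    {lam : ℝ} {G : Matrix (Fin N) (Fin N) ℝ} (hG : Gᵀ = G) {α : Fin N → ℝ}
    (hα : IsDualOptimal ℓ lam G α) {u : Fin N → ℝ}
    (hu : ∀ t, u t = -(1 / (lam * N) * (G *ᵥ α) t)) (v : Fin N → ℝ) :
    ∑ t, ℓ (u t) + ∑ t, α t * (v t - u t) ≤ ∑ t, ℓ (v t) := by
  obtain ⟨c, hc⟩ := hα.exists_convexConj_eq hℓ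
  choose β hβ using fun t => exists_subgradient hℓ (u t)
  have hc' : ∀ t w, α t * w - ℓ w ≤ c t := fun t => convexConj_le_coe_iff.1 (hc t).le
  set γ := β - α with hγ
  have key : 0 ≤ ∑ t, (β t * u t - ℓ (u t) - c t) + 1 / (lam * N) * (γ ⬝ᵥ (G *ᵥ α)) := by
    apply nonneg_of_forall_small (b := 1 / (2 * lam * N) * (γ ⬝ᵥ (G *ᵥ γ)))
    intro s hs hs1
    have h := (coe_le_dualObjective (lam := lam) (G := G) (α := α + s • γ)
      (c := fun t => (1 - s) * c t + s * (β t * u t - ℓ (u t))) fun t =>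
        convexConj_le_coe_iff.2 fun w => by
          have h1 := mul_le_mul_of_nonneg_left (hc' t w) (sub_nonneg.2 hs1)
          have h2 := mul_le_mul_of_nonneg_left (hβ t w) hs.le
          simp only [hγ, Pi.add_apply, Pi.smul_apply, Pi.sub_apply, smul_eq_mul]
          nlinarith).trans (hα _)
    rw [dualObjective_eq_coe hc, EReal.coe_le_coe_iff] at h
    have hsymm : α ⬝ᵥ (G *ᵥ γ) = γ ⬝ᵥ (G *ᵥ α) := by
      rw [dotProduct_mulVec, ← mulVec_transpose, hG, dotProduct_comm]
    have hexp : (α + s • γ) ⬝ᵥ (G *ᵥ (α + s • γ))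
        = α ⬝ᵥ (G *ᵥ α) + 2 * s * (γ ⬝ᵥ (G *ᵥ α)) + s ^ 2 * (γ ⬝ᵥ (G *ᵥ γ)) := by
      simp only [mulVec_add, mulVec_smul, add_dotProduct, dotProduct_add, smul_dotProduct,
        dotProduct_smul, smul_eq_mul, hsymm]
      ring
    have hsum : ∑ t, ((1 - s) * c t + s * (β t * u t - ℓ (u t)))
        = ∑ t, c t + s * ∑ t, (β t * u t - ℓ (u t) - c t) := by
      rw [Finset.mul_sum, ← Finset.sum_add_distrib]
      exact Finset.sum_congr rfl fun t _ => by ring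
    rw [hexp, hsum] at h
    have hk : 1 / (lam * N) = 2 * (1 / (2 * lam * N)) := by
      rw [mul_assoc, one_div, one_div, mul_inv 2]; ring
    rw [hk]
    linarith
  have hdot : 1 / (lam * N) * (γ ⬝ᵥ (G *ᵥ α)) = ∑ t, -(β t - α t) * u t := by
    rw [dotProduct, Finset.mul_sum]
    refine Finset.sum_congr rfl fun t _ => ?_
    rw [hu, hγ, Pi.sub_apply]
    ring
  rw [hdot, ← Finset.sum_add_distrib] at key
  rw [← Finset.sum_add_distrib, ← sub_nonneg, ← Finset.sum_sub_distrib]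
  refine key.trans (Finset.sum_le_sum fun t _ => ?_)
  linarith [hc' t (v t)]

theorem matInner_eq_sum {p q : ℕ} (A B : Matrix (Fin p) (Fin q) ℝ) :
    matInner A B = ∑ i, ∑ j, A i j * B i j := by
  simp only [matInner, trace, diag_apply, mul_apply, transpose_apply]
  exact Finset.sum_comm

theorem matInner_comm {p q : ℕ} (A B : Matrix (Fin p) (Fin q) ℝ) :
    matInner A B = matInner B A := by
  simp only [matInner_eq_sum, mul_comm]

theorem matInner_add_left {p q : ℕ} (A B C : Matrix (Fin p) (Fin q) ℝ) :
    matInner (A + B) C = matInner A C + matInner B C := by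
  simp [matInner, Matrix.add_mul]

theorem matInner_sub_left {p q : ℕ} (A B C : Matrix (Fin p) (Fin q) ℝ) :
    matInner (A - B) C = matInner A C - matInner B C := by
  simp [matInner, Matrix.sub_mul]

theorem matInner_smul_left {p q : ℕ} (s : ℝ) (A B : Matrix (Fin p) (Fin q) ℝ) :
    matInner (s • A) B = s * matInner A B := by
  simp [matInner]

theorem matInner_add_right {p q : ℕ} (A B C : Matrix (Fin p) (Fin q) ℝ) :
    matInner A (B + C) = matInner A B + matInner A C := by
  simp [matInner, Matrix.mul_add]

theorem matInner_sub_right {p q : ℕ} (A B C : Matrix (Fin p) (Fin q) ℝ) :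
    matInner A (B - C) = matInner A B - matInner A C := by
  simp [matInner, Matrix.mul_sub]

theorem matInner_smul_right {p q : ℕ} (s : ℝ) (A B : Matrix (Fin p) (Fin q) ℝ) :
    matInner A (s • B) = s * matInner A B := by
  simp [matInner]

theorem norm_sq_eq_matInner {p q : ℕ} (A : Matrix (Fin p) (Fin q) ℝ) :
    ‖A‖ ^ 2 = matInner A A := by
  rw [frobenius_norm_def, matInner_eq_sum, ← Real.sqrt_eq_rpow, Real.sq_sqrt (by positivity)]
  simp [sq]

theorem matInner_sum_left {p q N : ℕ} (α : Fin N → ℝ) (A : Fin N → Matrix (Fin p) (Fin q) ℝ)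
    (B : Matrix (Fin p) (Fin q) ℝ) :
    matInner (∑ t, α t • A t) B = ∑ t, α t * matInner (A t) B := by
  simp [matInner, transpose_sum, Matrix.sum_mul, trace_sum]

theorem matInner_le_norm_mul_norm {p q : ℕ} (A B : Matrix (Fin p) (Fin q) ℝ) :
    matInner A B ≤ ‖A‖ * ‖B‖ := by
  refine le_of_sq_le_sq ?_ (by positivity)
  rw [mul_pow, norm_sq_eq_matInner, norm_sq_eq_matInner]
  simp only [matInner_eq_sum, ← Finset.sum_product', Finset.univ_product_univ]
  simpa only [sq] using Finset.sum_mul_sq_le_sq_mul_sq Finset.univ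
    (fun x : Fin p × Fin q => A x.1 x.2) (fun x => B x.1 x.2)

/-- First-order optimality of the primal minimizer, in the direction of `M'`. -/
theorem IsPrimalOptimal.variational {d N : ℕ} {ℓ : ℝ → ℝ} (hℓ : ConvexOn ℝ Set.univ ℓ)
    {lam : ℝ} {A : Fin N → Matrix (Fin d) (Fin d) ℝ} {M : Matrix (Fin d) (Fin d) ℝ}
    (hM : IsPrimalOptimal ℓ lam A M) {M' : Matrix (Fin d) (Fin d) ℝ} (hM' : M'.IsSymm) :
    0 ≤ lam * matInner M (M' - M)
      + 1 / (N : ℝ) * (∑ t, ℓ (matInner M' (A t)) - ∑ t, ℓ (matInner M (A t))) := by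
  apply nonneg_of_forall_small (b := lam / 2 * ‖M' - M‖ ^ 2)
  intro s hs hs1
  have h := hM.2 (M + s • (M' - M)) (by
    have h1 : Mᵀ = M := hM.1
    have h2 : M'ᵀ = M' := hM'
    rw [Matrix.IsSymm, transpose_add, transpose_smul, transpose_sub, h1, h2])
  have hconv : ∑ t, ℓ (matInner (M + s • (M' - M)) (A t))
      ≤ ∑ t, ℓ (matInner M (A t))
        + s * (∑ t, ℓ (matInner M' (A t)) - ∑ t, ℓ (matInner M (A t))) := by
    rw [← Finset.sum_sub_distrib, Finset.mul_sum, ← Finset.sum_add_distrib]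
    refine Finset.sum_le_sum fun t _ => ?_
    have := hℓ.2 (Set.mem_univ (matInner M (A t))) (Set.mem_univ (matInner M' (A t)))
      (sub_nonneg.2 hs1) hs.le (by ring)
    simp only [smul_eq_mul] at this
    rw [matInner_add_left, matInner_smul_left, matInner_sub_left]
    calc _ = ℓ ((1 - s) * matInner M (A t) + s * matInner M' (A t)) := by congr 1; ring
      _ ≤ _ := this
      _ = _ := by ring
  have hN := mul_le_mul_of_nonneg_left hconv (show (0 : ℝ) ≤ 1 / (N : ℝ) by positivity)
  have hnorm : ‖M + s • (M' - M)‖ ^ 2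
      = ‖M‖ ^ 2 + 2 * s * matInner M (M' - M) + s ^ 2 * ‖M' - M‖ ^ 2 := by
    simp only [norm_sq_eq_matInner, matInner_add_left, matInner_add_right, matInner_smul_left,
      matInner_smul_right, matInner_comm (M' - M) M]
    ring
  simp only [primalObjective] at h
  rw [hnorm] at h
  linarith

/-! ### Projection onto the positive semidefinite cone -/

theorem psdProj_posSemidef {d : ℕ} (M : Matrix (Fin d) (Fin d) ℝ) : (psdProj M).PosSemidef :=
  (Classical.choose_spec (exists_isPSDProjection M)).1

/-- The variational inequality that characterizes the projection onto a convex cone. -/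
theorem matInner_sub_psdProj_nonpos {d : ℕ} (M : Matrix (Fin d) (Fin d) ℝ)
    {Q : Matrix (Fin d) (Fin d) ℝ} (hQ : Q.PosSemidef) :
    matInner (M - psdProj M) (Q - psdProj M) ≤ 0 := by
  have hP := psdProj_posSemidef M
  suffices h : 0 ≤ -2 * matInner (M - psdProj M) (Q - psdProj M) by linarith
  apply nonneg_of_forall_small (b := ‖Q - psdProj M‖ ^ 2)
  intro s hs hs1
  have hmem : (psdProj M + s • (Q - psdProj M)).PosSemidef := by
    have : psdProj M + s • (Q - psdProj M) = (1 - s) • psdProj M + s • Q := by module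
    rw [this]
    exact (hP.smul (sub_nonneg.2 hs1)).add (hQ.smul hs.le)
  have h := (Classical.choose_spec (exists_isPSDProjection M)).2 _ hmem
  change ‖M - psdProj M‖ ≤ _ at h
  have h2 := pow_le_pow_left₀ (norm_nonneg _) h 2
  have hexp : ‖M - (psdProj M + s • (Q - psdProj M))‖ ^ 2 = ‖M - psdProj M‖ ^ 2
      - 2 * s * matInner (M - psdProj M) (Q - psdProj M) + s ^ 2 * ‖Q - psdProj M‖ ^ 2 := by
    rw [← sub_sub]
    simp only [norm_sq_eq_matInner, matInner_sub_left _ (s • _), matInner_sub_right _ _ (s • _),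
      matInner_smul_left, matInner_smul_right, matInner_comm (Q - psdProj M) (M - psdProj M)]
    ring
  rw [hexp] at h2
  linarith

/-- The projection onto the positive semidefinite cone is nonexpansive in Frobenius norm. -/
theorem norm_psdProj_sub_le {d : ℕ} (M M' : Matrix (Fin d) (Fin d) ℝ) :
    ‖psdProj M - psdProj M'‖ ≤ ‖M - M'‖ := by
  have h1 := matInner_sub_psdProj_nonpos M (psdProj_posSemidef M')
  have h2 := matInner_sub_psdProj_nonpos M' (psdProj_posSemidef M)
  have h3 : ‖psdProj M - psdProj M'‖ ^ 2 ≤ matInner (M - M') (psdProj M - psdProj M') := by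
    rw [norm_sq_eq_matInner]
    simp only [matInner_sub_left, matInner_sub_right] at *
    linarith [matInner_comm (psdProj M) (psdProj M')]
  have h4 := h3.trans (matInner_le_norm_mul_norm _ _)
  rcases (norm_nonneg (psdProj M - psdProj M')).eq_or_lt with h | h
  · rw [← h]; exact norm_nonneg _
  · rw [sq] at h4
    exact le_of_mul_le_mul_right h4 h

/-! ### Dual recovery under a near-isometric projection -/

theorem matInner_mul_mul {p q : ℕ} (S : Matrix (Fin p) (Fin p) ℝ) (T : Matrix (Fin q) (Fin q) ℝ)
    (A B : Matrix (Fin p) (Fin q) ℝ) :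
    matInner (S * A * T) B = matInner A (Sᵀ * B * Tᵀ) := by
  simp only [matInner, transpose_mul, Matrix.mul_assoc]
  rw [Matrix.trace_mul_comm]
  simp only [Matrix.mul_assoc]

/-- Conjugation by `Z` intertwines `B ↦ S B S` with the same map for the compression `Zᵀ S Z`. -/
theorem matInner_conj {d r : ℕ} (Z : Matrix (Fin d) (Fin r) ℝ)
    (B C : Matrix (Fin r) (Fin r) ℝ) (S : Matrix (Fin d) (Fin d) ℝ) :
    matInner (Z * B * Zᵀ) (S * (Z * C * Zᵀ) * S)
      = matInner B ((Zᵀ * S * Z) * C * (Zᵀ * S * Z)) := by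
  simp only [matInner, transpose_mul, Matrix.mul_assoc, transpose_transpose]
  rw [Matrix.trace_mul_comm]
  simp only [Matrix.mul_assoc]

/-- The hypotheses on `Z` and `h` say that `Z` is an orthonormal eigenbasis of the compression of
`S = R Rᵀ` to a subspace supporting all `A t`, with eigenvalues `h`. If the products
`h a * h b`, which are the eigenvalues of `B ↦ S B S` on that space, are within `η` of `1`, then
the metric recovered from the projected dual is relatively `η / (1 - η)`-close to the primal
optimum. -/
theorem norm_sub_recoveredMetric_le {d m N r : ℕ} {ℓ : ℝ → ℝ} (hℓ : ConvexOn ℝ Set.univ ℓ)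
    {lam : ℝ} (hlam : 0 < lam) {A : Fin N → Matrix (Fin d) (Fin d) ℝ}
    (hA : ∀ t, (A t)ᵀ = A t) {M : Matrix (Fin d) (Fin d) ℝ} (hM : IsPrimalOptimal ℓ lam A M)
    (R : Matrix (Fin d) (Fin m) ℝ) (Z : Matrix (Fin d) (Fin r) ℝ) (hZ : Zᵀ * Z = 1)
    (hZA : ∀ t, (Z * Zᵀ) * A t * (Z * Zᵀ) = A t) (h : Fin r → ℝ)
    (hdiag : Zᵀ * (R * Rᵀ) * Z = diagonal h) {η : ℝ} (hη : η < 1)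
    (hh : ∀ a b, |1 - h a * h b| ≤ η) (hη0 : 0 ≤ η) {α : Fin N → ℝ}
    (hα : IsDualOptimal ℓ lam (gram (projected R A)) α) :
    ‖M - recoveredMetric lam A α‖ ≤ η / (1 - η) * ‖M‖ := by
  set S := R * Rᵀ
  have hST : Sᵀ = S := by simp [S]
  set Mh := recoveredMetric lam A α with hMh
  have hMsymm : Mᵀ = M := hM.1
  have hMhsymm : Mhᵀ = Mh := by
    simp [hMh, recoveredMetric, transpose_sum, hA]
  have hMhZ : (Z * Zᵀ) * Mh * (Z * Zᵀ) = Mh := by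
    simp only [hMh, recoveredMetric, Matrix.mul_neg, Matrix.neg_mul, Matrix.mul_smul,
      Matrix.smul_mul, Matrix.mul_sum, Matrix.sum_mul, hZA]
  have hZZT : (Z * Zᵀ)ᵀ = Z * Zᵀ := by simp
  -- compressing `M` to the supporting subspace preserves the losses, so optimality forces
  -- `M` to be supported there
  have hMZ : (Z * Zᵀ) * M * (Z * Zᵀ) = M := by
    set M₁ := (Z * Zᵀ) * M * (Z * Zᵀ) with hM₁
    have hsymm : M₁.IsSymm := by
      rw [Matrix.IsSymm, hM₁, transpose_mul _ (Z * Zᵀ), transpose_mul _ M, hZZT, hMsymm,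
        ← Matrix.mul_assoc]
    have hv := hM.variational hℓ hsymm
    have hloss : ∀ t, matInner M₁ (A t) = matInner M (A t) := fun t => by
      rw [hM₁, matInner_mul_mul, hZZT, hZA]
    simp only [hloss, sub_self, mul_zero, add_zero] at hv
    have hpos : 0 ≤ matInner M (M₁ - M) := nonneg_of_mul_nonneg_right hv hlam
    have hidem : matInner M₁ M₁ = matInner M M₁ := by
      conv_lhs => rw [hM₁, matInner_mul_mul, hZZT]
      congr 1
      rw [hM₁]
      simp only [Matrix.mul_assoc]
      rw [← Matrix.mul_assoc Zᵀ Z, hZ, Matrix.one_mul, ← Matrix.mul_assoc Zᵀ Z, hZ,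
        Matrix.one_mul]
    have hz : ‖M₁ - M‖ ^ 2 ≤ 0 := by
      rw [norm_sq_eq_matInner]
      simp only [matInner_sub_left, matInner_sub_right] at hpos ⊢
      linarith [matInner_comm M M₁]
    have : ‖M₁ - M‖ = 0 := by nlinarith [norm_nonneg (M₁ - M)]
    exact sub_eq_zero.1 (norm_eq_zero.1 this)
  -- the optimality conditions of the two problems, at the common margins `⟨S Mh S, A t⟩`
  have hsymm' : (S * Mh * S).IsSymm := by
    rw [Matrix.IsSymm, transpose_mul _ S, transpose_mul _ Mh, hST, hMhsymm, ← Matrix.mul_assoc]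
  have hprimal := hM.variational hℓ hsymm'
  have hrec : ∀ B, 1 / (lam * N) * ∑ t, α t * matInner (A t) B = -matInner Mh B := fun B => by
    rw [hMh, recoveredMetric, ← neg_smul, matInner_smul_left, matInner_sum_left]
    ring
  have hGram : ∀ a b, gram (projected R A) a b = matInner (A b) (S * A a * S) := fun a b => by
    simp only [gram, projected, of_apply, matInner, transpose_mul, transpose_transpose, hA, S]
    rw [Matrix.trace_mul_comm (A b)]
    simp only [Matrix.mul_assoc]
    rw [Matrix.trace_mul_comm, Matrix.trace_mul_comm R]
    simp only [Matrix.mul_assoc]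
    rw [Matrix.trace_mul_comm Rᵀ]
    simp only [Matrix.mul_assoc]
  have hGsymm : (gram (projected R A))ᵀ = gram (projected R A) := by
    ext a b
    simp only [transpose_apply, gram, of_apply]
    exact matInner_comm _ _
  have hdual := hα.sum_le hℓ hGsymm (u := fun t => matInner (S * Mh * S) (A t)) (fun t => by
    rw [matInner_mul_mul, hST, ← neg_eq_iff_eq_neg, ← hrec, mulVec, dotProduct]
    congr 1
    exact Finset.sum_congr rfl fun s _ => by rw [hGram, mul_comm]) fun t => matInner M (A t)
  have hdual' : ∑ t, α t * (matInner M (A t) - matInner (S * Mh * S) (A t))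
      = ∑ t, α t * matInner (A t) (M - S * Mh * S) :=
    Finset.sum_congr rfl fun t _ => by
      rw [matInner_sub_right, matInner_comm M, matInner_comm (S * Mh * S)]
  rw [hdual'] at hdual
  have hmono : matInner (Mh - M) (S * Mh * S - M) ≤ 0 := by
    have h1 : 0 ≤ lam * (1 / (lam * N)) := by positivity
    have h2 : lam * (1 / (lam * N)) = 1 / (N : ℝ) := by field_simp
    have h3 := mul_le_mul_of_nonneg_left hdual h1
    have h4 := hrec (M - S * Mh * S)
    have h5 : lam * (1 / (lam * N)) * ∑ t, α t * matInner (A t) (M - S * Mh * S)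
        = -(lam * matInner Mh (M - S * Mh * S)) := by
      rw [mul_assoc, h4]; ring
    rw [mul_add, h5, h2] at h3
    have h6 : 0 ≤ lam * (matInner M (S * Mh * S - M) + matInner Mh (M - S * Mh * S)) := by
      linarith
    have h7 := nonneg_of_mul_nonneg_right h6 hlam
    simp only [matInner_sub_left, matInner_sub_right] at h7 ⊢
    linarith
  -- in the eigenbasis the two-sided product with `S` multiplies the entries by `h a * h b`
  set B := Zᵀ * M * Z with hB
  set C := Zᵀ * Mh * Z with hC
  have hMB : M = Z * B * Zᵀ := by
    conv_lhs => rw [← hMZ]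
    rw [hB]; simp only [Matrix.mul_assoc]
  have hMC : Mh = Z * C * Zᵀ := by
    conv_lhs => rw [← hMhZ]
    rw [hC]; simp only [Matrix.mul_assoc]
  have hnorm : ∀ D : Matrix (Fin r) (Fin r) ℝ, ‖Z * D * Zᵀ‖ = ‖D‖ := fun D => by
    rw [← sq_eq_sq₀ (norm_nonneg _) (norm_nonneg _), norm_sq_eq_matInner, norm_sq_eq_matInner]
    have := matInner_conj Z D D 1
    simpa [hZ] using this
  have hsub : Mh - M = Z * (C - B) * Zᵀ := by
    rw [Matrix.mul_sub, Matrix.sub_mul, ← hMB, ← hMC]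
  have hmono' : ∑ a, ∑ b, (C a b - B a b) * (h a * h b * C a b - B a b) ≤ 0 := by
    have h1 : matInner (Mh - M) (S * Mh * S) = matInner (C - B) (diagonal h * C * diagonal h) := by
      rw [hsub]
      conv_lhs => rw [hMC]
      rw [matInner_conj Z _ _ S, hdiag]
    have h2 : matInner (Mh - M) M = matInner (C - B) B := by
      rw [hsub]
      conv_lhs => rw [hMB]
      have := matInner_conj Z (C - B) B 1
      simpa [hZ] using this
    rw [matInner_sub_right, h1, h2, ← matInner_sub_right, matInner_eq_sum] at hmono
    refine le_of_eq_of_le (Finset.sum_congr rfl fun a _ => Finset.sum_congr rfl fun b _ => ?_) hmono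
    simp only [Matrix.sub_apply, mul_diagonal, diagonal_mul]
    ring
  have hfin : (1 - η) * ‖C - B‖ ^ 2 ≤ η * (‖C - B‖ * ‖B‖) := by
    have habs : ∑ a, ∑ b, |C a b - B a b| * |B a b| ≤ ‖C - B‖ * ‖B‖ := by
      have := matInner_le_norm_mul_norm ((C - B).map fun y => |y|) (B.map fun y => |y|)
      rw [matInner_eq_sum] at this
      simpa only [map_apply, Matrix.sub_apply, frobenius_norm_def, Real.norm_eq_abs, abs_abs] using this
    have hentry : ∀ a b, (1 - η) * (C a b - B a b) ^ 2
        ≤ (C a b - B a b) * (h a * h b * C a b - B a b)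
          + η * (|C a b - B a b| * |B a b|) := fun a b => by
      have h1 := abs_le.1 (hh a b)
      have h2 : (1 - h a * h b) * ((C a b - B a b) * B a b)
          ≤ η * (|C a b - B a b| * |B a b|) := by
        rw [← abs_mul]
        refine (le_abs_self _).trans ?_
        rw [abs_mul]
        gcongr
        exact hh a b
      nlinarith [sq_nonneg (C a b - B a b)]
    have := Finset.sum_le_sum fun a (_ : a ∈ Finset.univ) =>
      Finset.sum_le_sum fun b (_ : b ∈ Finset.univ) => hentry a b
    simp only [Finset.sum_add_distrib, ← Finset.mul_sum] at this
    have hn : ‖C - B‖ ^ 2 = ∑ a, ∑ b, (C a b - B a b) ^ 2 := by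
      rw [norm_sq_eq_matInner, matInner_eq_sum]
      simp [sq]
    rw [hn]
    nlinarith [mul_le_mul_of_nonneg_left habs hη0]
  have hfin' : ‖C - B‖ ≤ η / (1 - η) * ‖B‖ := by
    rcases (norm_nonneg (C - B)).eq_or_lt with h0 | h0
    · rw [← h0]
      have : 0 < 1 - η := by linarith
      positivity
    · rw [div_mul_eq_mul_div, le_div_iff₀ (by linarith)]
      refine le_of_mul_le_mul_left ?_ h0
      linarith
  have hMn : ‖M‖ = ‖B‖ := by rw [hMB, hnorm]
  rw [norm_sub_rev, hsub, hnorm, hMn]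
  exact hfin'

/-! ### Gaussian integration by parts -/

theorem integrable_gaussianReal_iff {v : ℝ≥0} (hv : v ≠ 0) {f : ℝ → ℝ} :
    Integrable f (gaussianReal 0 v) ↔ Integrable fun x => gaussianPDFReal 0 v x * f x := by
  rw [gaussianReal_of_var_ne_zero 0 hv,
    integrable_withDensity_iff_integrable_smul' (measurable_gaussianPDF 0 v)
      (Filter.Eventually.of_forall fun x => gaussianPDF_lt_top)]
  simp [toReal_gaussianPDF]

theorem hasDerivAt_gaussianPDFReal (v : ℝ≥0) (x : ℝ) :
    HasDerivAt (gaussianPDFReal 0 v) (-(x / v) * gaussianPDFReal 0 v x) x := by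
  have h : HasDerivAt (fun y : ℝ => -(y - 0) ^ 2 / (2 * v)) (-(x / v)) x := by
    have h1 : HasDerivAt (fun y : ℝ => -(y - 0) ^ 2 / (2 * v)) (-(2 * x) / (2 * v)) x := by
      simpa using (((hasDerivAt_id x).pow 2).neg.div_const (2 * (v : ℝ)))
    convert h1 using 1
    rw [neg_div, mul_div_mul_left _ _ two_ne_zero]
  rw [gaussianPDFReal_def]
  exact (h.exp.const_mul (√(2 * Real.pi * v))⁻¹).congr_deriv (by ring)

/-- Stein's identity for a centred Gaussian variable. -/
theorem integral_id_mul_gaussianReal {v : ℝ≥0} (hv : v ≠ 0) {f f' : ℝ → ℝ}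
    (hf : ∀ x, HasDerivAt f (f' x) x) (hi : Integrable f (gaussianReal 0 v))
    (hi' : Integrable f' (gaussianReal 0 v))
    (hxi : Integrable (fun x => x * f x) (gaussianReal 0 v)) :
    ∫ x, x * f x ∂gaussianReal 0 v = v * ∫ x, f' x ∂gaussianReal 0 v := by
  have hv' : (v : ℝ) ≠ 0 := by exact_mod_cast hv
  rw [integrable_gaussianReal_iff hv] at hi hi' hxi
  have h := integral_mul_deriv_eq_deriv_mul_of_integrable (u := f) (u' := f')
    (v := gaussianPDFReal 0 v) (v' := fun x => -(x / v) * gaussianPDFReal 0 v x)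
    (fun x _ => hf x) (fun x _ => hasDerivAt_gaussianPDFReal v x)
    ((hxi.const_mul (-(1 / (v : ℝ)))).congr (Filter.Eventually.of_forall fun x => by
      simp only [Pi.mul_apply]; ring))
    (hi'.congr (Filter.Eventually.of_forall fun x => by simp only [Pi.mul_apply]; ring))
    (hi.congr (Filter.Eventually.of_forall fun x => by simp only [Pi.mul_apply]; ring))
  rw [integral_gaussianReal_eq_integral_smul hv, integral_gaussianReal_eq_integral_smul hv]
  have h1 : ∫ x, f x * (-(x / v) * gaussianPDFReal 0 v x)
      = -(1 / (v : ℝ)) * ∫ x, gaussianPDFReal 0 v x • (x * f x) := by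
    rw [← integral_const_mul]
    exact integral_congr_ae (Filter.Eventually.of_forall fun x => by
      simp only [smul_eq_mul]; ring)
  have h2 : ∫ x, f' x * gaussianPDFReal 0 v x = ∫ x, gaussianPDFReal 0 v x • f' x :=
    integral_congr_ae (Filter.Eventually.of_forall fun x => by
      simp only [smul_eq_mul]; ring)
  rw [h1, h2] at h
  field_simp at h
  linarith

variable {ι : Type*} [Fintype ι]

/-- Resampling one coordinate of a product measure preserves the measure. -/
theorem measurePreserving_update [DecidableEq ι] (μ : ι → Measure ℝ)
    [∀ i, IsProbabilityMeasure (μ i)] (i : ι) :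
    MeasurePreserving (fun p : (ι → ℝ) × ℝ => Function.update p.1 i p.2)
      ((Measure.pi μ).prod (μ i)) (Measure.pi μ) := by
  have hm : Measurable (fun p : (ι → ℝ) × ℝ => Function.update p.1 i p.2) := by
    refine measurable_pi_iff.2 fun j => ?_
    by_cases h : j = i
    · subst h; simpa using measurable_snd
    · simpa [Function.update_of_ne h, Function.comp_def] using
        (measurable_pi_apply j).comp measurable_fst
  refine ⟨hm, (Measure.pi_eq fun s hs => ?_).symm⟩
  rw [Measure.map_apply hm (MeasurableSet.univ_pi hs)]
  have hpre : (fun p : (ι → ℝ) × ℝ => Function.update p.1 i p.2) ⁻¹' Set.univ.pi s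
      = (Set.univ.pi (Function.update s i Set.univ)) ×ˢ s i := by
    ext p
    simp only [Set.mem_preimage, Set.mem_pi, Set.mem_univ, true_imp_iff, Set.mem_prod]
    constructor
    · intro h
      refine ⟨fun j => ?_, by simpa using h i⟩
      by_cases hj : j = i
      · subst hj; simp
      · simpa [Function.update_of_ne hj] using h j
    · rintro ⟨h, hi⟩ j
      by_cases hj : j = i
      · subst hj; simpa using hi
      · simpa [Function.update_of_ne hj] using h j
  rw [hpre, Measure.prod_prod, Measure.pi_pi, ← Finset.mul_prod_erase _ _ (Finset.mem_univ i),
    ← Finset.mul_prod_erase Finset.univ (fun j => μ j (s j)) (Finset.mem_univ i)]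
  simp only [Function.update_self, measure_univ, one_mul]
  rw [mul_comm]
  congr 1
  exact Finset.prod_congr rfl fun j hj => by
    rw [Function.update_of_ne (Finset.ne_of_mem_erase hj)]

/-- Stein's identity for a family of independent centred Gaussian variables. -/
theorem integral_coord_mul [DecidableEq ι] {v : ℝ≥0} (hv : v ≠ 0) (i : ι) {F F' : (ι → ℝ) → ℝ}
    (hF : ∀ x, HasDerivAt (fun t => F (Function.update x i t)) (F' x) (x i))
    (hi : Integrable F (Measure.pi fun _ => gaussianReal 0 v))
    (hi' : Integrable F' (Measure.pi fun _ => gaussianReal 0 v))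
    (hxi : Integrable (fun x => x i * F x) (Measure.pi fun _ => gaussianReal 0 v)) :
    ∫ x, x i * F x ∂(Measure.pi fun _ => gaussianReal 0 v)
      = v * ∫ x, F' x ∂(Measure.pi fun _ => gaussianReal 0 v) := by
  have mp := measurePreserving_update (fun _ : ι => gaussianReal 0 v) i
  have slice : ∀ {g : (ι → ℝ) → ℝ}, Integrable g (Measure.pi fun _ => gaussianReal 0 v) →
      Integrable (fun p : (ι → ℝ) × ℝ => g (Function.update p.1 i p.2))
        ((Measure.pi fun _ : ι => gaussianReal 0 v).prod (gaussianReal 0 v)) := fun hg =>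
    mp.integrable_comp_of_integrable hg
  have fub : ∀ {g : (ι → ℝ) → ℝ}, Integrable g (Measure.pi fun _ => gaussianReal 0 v) →
      ∫ x, g x ∂(Measure.pi fun _ => gaussianReal 0 v)
        = ∫ x, ∫ t, g (Function.update x i t) ∂gaussianReal 0 v
            ∂(Measure.pi fun _ => gaussianReal 0 v) := fun {g} hg => by
    rw [← integral_prod _ (slice hg), ← integral_map (f := g) mp.measurable.aemeasurable
      (by rw [mp.map_eq]; exact hg.aestronglyMeasurable), mp.map_eq]
  rw [fub hxi, fub hi', ← integral_const_mul]
  refine integral_congr_ae ?_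
  filter_upwards [(slice hi).prod_right_ae, (slice hi').prod_right_ae,
    (slice hxi).prod_right_ae] with x h1 h2 h3
  simp only [Function.update_self] at h3 ⊢
  refine integral_id_mul_gaussianReal hv (fun t => ?_) h1 h2 h3
  simpa using hF (Function.update x i t)

/-- Continuous functions of at most polynomial growth. -/
def PolyGrowth (F : (ι → ℝ) → ℝ) : Prop :=
  Continuous F ∧ ∃ (C : ℝ) (K : ℕ), ∀ x, |F x| ≤ C * (1 + ‖x‖) ^ K

namespace PolyGrowth

variable {F G : (ι → ℝ) → ℝ}

theorem of_bounded (hF : Continuous F) {C : ℝ} (h : ∀ x, |F x| ≤ C) : PolyGrowth F :=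
  ⟨hF, C, 0, by simpa using h⟩

theorem coord (i : ι) : PolyGrowth fun x : ι → ℝ => x i :=
  ⟨continuous_apply i, 1, 1, fun x => by
    have := norm_le_pi_norm x i
    rw [Real.norm_eq_abs] at this
    linarith⟩

theorem mul (hF : PolyGrowth F) (hG : PolyGrowth G) : PolyGrowth fun x => F x * G x := by
  obtain ⟨hc, C, K, h⟩ := hF
  obtain ⟨hc', C', K', h'⟩ := hG
  refine ⟨hc.mul hc', C * C', K + K', fun x => ?_⟩
  rw [abs_mul, pow_add]
  calc |F x| * |G x| ≤ (C * (1 + ‖x‖) ^ K) * (C' * (1 + ‖x‖) ^ K') :=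
        mul_le_mul (h x) (h' x) (abs_nonneg _) ((abs_nonneg _).trans (h x))
    _ = _ := by ring

theorem add (hF : PolyGrowth F) (hG : PolyGrowth G) : PolyGrowth fun x => F x + G x := by
  obtain ⟨hc, C, K, h⟩ := hF
  obtain ⟨hc', C', K', h'⟩ := hG
  have hC : 0 ≤ C := by simpa using (abs_nonneg _).trans (h 0)
  have hC' : 0 ≤ C' := by simpa using (abs_nonneg _).trans (h' 0)
  refine ⟨hc.add hc', C + C', max K K', fun x => ?_⟩
  have h1 : (1 : ℝ) ≤ 1 + ‖x‖ := by linarith [norm_nonneg x]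
  calc |F x + G x| ≤ |F x| + |G x| := abs_add_le _ _
    _ ≤ C * (1 + ‖x‖) ^ K + C' * (1 + ‖x‖) ^ K' := add_le_add (h x) (h' x)
    _ ≤ C * (1 + ‖x‖) ^ (max K K') + C' * (1 + ‖x‖) ^ (max K K') := by
        gcongr
        · exact le_max_left _ _
        · exact le_max_right _ _
    _ = _ := by ring

theorem const (c : ℝ) : PolyGrowth fun _ : ι → ℝ => c :=
  of_bounded continuous_const (C := |c|) fun _ => le_rfl

theorem sum {κ : Type*} (s : Finset κ) {F : κ → (ι → ℝ) → ℝ} (h : ∀ k, PolyGrowth (F k)) :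
    PolyGrowth fun x => ∑ k ∈ s, F k x := by
  classical
  induction s using Finset.induction_on with
  | empty => simpa using const 0
  | insert a s ha ih => simpa [Finset.sum_insert ha] using (h a).add ih

theorem integrable (hF : PolyGrowth F) (v : ℝ≥0) :
    Integrable F (Measure.pi fun _ => gaussianReal 0 v) := by
  obtain ⟨hc, C, K, h⟩ := hF
  have hid : MemLp (fun x : ι → ℝ => x) (K : ℝ≥0∞) (Measure.pi fun _ => gaussianReal 0 v) :=
    memLp_pi_iff.2 fun i => (memLp_id_gaussianReal' K (by simp)).comp_measurePreserving
      (measurePreserving_eval (fun _ : ι => gaussianReal 0 v) i)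
  have hadd : MemLp (fun x : ι → ℝ => (1 : ℝ) + ‖x‖) (K : ℝ≥0∞)
      (Measure.pi fun _ => gaussianReal 0 v) := by
    have hone : MemLp (fun _ : ι → ℝ => (1 : ℝ)) (K : ℝ≥0∞)
      (Measure.pi fun _ => gaussianReal 0 v) := memLp_const 1
    exact hone.add hid.norm
  have hint : Integrable (fun x : ι → ℝ => ‖(1 : ℝ) + ‖x‖‖ ^ K)
      (Measure.pi fun _ => gaussianReal 0 v) := hadd.integrable_norm_pow'
  refine (hint.const_mul C).mono' hc.aestronglyMeasurable
    (Filter.Eventually.of_forall fun x => (h x).trans (le_of_eq ?_))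
  rw [Real.norm_eq_abs, abs_of_nonneg (by positivity)]

end PolyGrowth

/-! ### Traces of powers of a positive semidefinite matrix and of its resolvent -/

section Spectral

variable {r : ℕ} {V : Matrix (Fin r) (Fin r) ℝ}

theorem exists_orthogonal_diagonalization {H : Matrix (Fin r) (Fin r) ℝ} (hH : H.PosSemidef) :
    ∃ (V : Matrix (Fin r) (Fin r) ℝ) (h : Fin r → ℝ), Vᵀ * V = 1 ∧ (∀ i, 0 ≤ h i) ∧
      H = V * diagonal h * Vᵀ := by
  refine ⟨hH.isHermitian.eigenvectorUnitary, hH.isHermitian.eigenvalues, ?_,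
    hH.eigenvalues_nonneg, ?_⟩
  · have := (Unitary.mem_iff.1 hH.isHermitian.eigenvectorUnitary.2).1
    rwa [star_eq_conjTranspose, conjTranspose_eq_transpose_of_trivial] at this
  · conv_lhs => rw [hH.isHermitian.spectral_theorem, Unitary.conjStarAlgAut_apply]
    rw [star_eq_conjTranspose, conjTranspose_eq_transpose_of_trivial]
    rfl

theorem conj_diagonal_mul (hV : Vᵀ * V = 1) (w w' : Fin r → ℝ) :
    V * diagonal w * Vᵀ * (V * diagonal w' * Vᵀ) = V * diagonal (fun i => w i * w' i) * Vᵀ := by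
  rw [← diagonal_mul_diagonal]
  simp only [Matrix.mul_assoc]
  rw [← Matrix.mul_assoc Vᵀ V, hV, Matrix.one_mul]

theorem conj_diagonal_pow (hV : Vᵀ * V = 1) (w : Fin r → ℝ) (k : ℕ) :
    (V * diagonal w * Vᵀ) ^ k = V * diagonal (fun i => w i ^ k) * Vᵀ := by
  induction k with
  | zero => simp [mul_eq_one_comm.1 hV]
  | succ k ih =>
    rw [pow_succ, ih, conj_diagonal_mul hV]
    simp only [pow_succ]

theorem trace_conj_diagonal (hV : Vᵀ * V = 1) (w : Fin r → ℝ) :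
    (V * diagonal w * Vᵀ).trace = ∑ i, w i := by
  rw [Matrix.trace_mul_comm, ← Matrix.mul_assoc, hV, Matrix.one_mul, trace_diagonal]

/-- The resolvent `(H + τ)⁻¹`. -/
noncomputable def resolvent (τ : ℝ) (H : Matrix (Fin r) (Fin r) ℝ) : Matrix (Fin r) (Fin r) ℝ :=
  (H + τ • 1)⁻¹

theorem conj_diagonal_add_smul_one (hV : Vᵀ * V = 1) (h : Fin r → ℝ) (τ : ℝ) :
    V * diagonal h * Vᵀ + τ • 1 = V * diagonal (fun i => h i + τ) * Vᵀ := by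
  have h1 : diagonal (fun i => h i + τ) = diagonal h + τ • (1 : Matrix (Fin r) (Fin r) ℝ) := by
    rw [← diagonal_one, ← diagonal_smul, diagonal_add]
    simp
  rw [h1, Matrix.mul_add, Matrix.add_mul, Matrix.mul_smul, Matrix.mul_one, Matrix.smul_mul,
    mul_eq_one_comm.1 hV]

theorem conj_diagonal_mul_inv (hV : Vᵀ * V = 1) {h : Fin r → ℝ} (hh : ∀ i, 0 ≤ h i) {τ : ℝ}
    (hτ : 0 < τ) :
    (V * diagonal h * Vᵀ + τ • 1) * (V * diagonal (fun i => (h i + τ)⁻¹) * Vᵀ) = 1 := by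
  rw [conj_diagonal_add_smul_one hV, conj_diagonal_mul hV]
  have : (fun i => (h i + τ) * (h i + τ)⁻¹) = fun _ => 1 :=
    funext fun i => mul_inv_cancel₀ (by linarith [hh i])
  rw [this, diagonal_one, Matrix.mul_one, mul_eq_one_comm.1 hV]

theorem resolvent_conj_diagonal (hV : Vᵀ * V = 1) {h : Fin r → ℝ} (hh : ∀ i, 0 ≤ h i) {τ : ℝ}
    (hτ : 0 < τ) :
    resolvent τ (V * diagonal h * Vᵀ) = V * diagonal (fun i => (h i + τ)⁻¹) * Vᵀ :=
  Matrix.inv_eq_right_inv (conj_diagonal_mul_inv hV hh hτ)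

variable {H : Matrix (Fin r) (Fin r) ℝ}

theorem isUnit_add_smul_one (hH : H.PosSemidef) {τ : ℝ} (hτ : 0 < τ) : IsUnit (H + τ • 1) := by
  obtain ⟨V, h, hV, hh, rfl⟩ := exists_orthogonal_diagonalization hH
  exact IsUnit.of_mul_eq_one _ (conj_diagonal_mul_inv hV hh hτ)

theorem resolvent_transpose (hH : H.PosSemidef) (τ : ℝ) : (resolvent τ H)ᵀ = resolvent τ H := by
  have h1 : Hᵀ = H := hH.isHermitian
  rw [resolvent, transpose_nonsing_inv, transpose_add, transpose_smul, transpose_one, h1]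

theorem trace_pow_nonneg (hH : H.PosSemidef) (k : ℕ) : 0 ≤ (H ^ k).trace := by
  obtain ⟨V, h, hV, hh, rfl⟩ := exists_orthogonal_diagonalization hH
  rw [conj_diagonal_pow hV, trace_conj_diagonal hV]
  exact Finset.sum_nonneg fun i _ => pow_nonneg (hh i) k

theorem sum_pow_mul_sum_pow_le {w : Fin r → ℝ} (hw : ∀ i, 0 ≤ w i) (i j : ℕ) :
    (∑ a, w a ^ i) * (∑ a, w a ^ j) ≤ r * ∑ a, w a ^ (i + j) := by
  have hmono : MonovaryOn (fun a => w a ^ i) (fun a => w a ^ j) (Finset.univ : Finset (Fin r)) := by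
    intro a _ b _ hab
    exact pow_le_pow_left₀ (hw a) (lt_of_pow_lt_pow_left₀ j (hw b) hab).le i
  simpa [pow_add] using hmono.sum_mul_sum_le_card_mul_sum

/-- Chebyshev's sum inequality for the eigenvalues. -/
theorem trace_pow_mul_trace_pow_le (hH : H.PosSemidef) (i j : ℕ) :
    (H ^ i).trace * (H ^ j).trace ≤ r * (H ^ (i + j)).trace := by
  obtain ⟨V, h, hV, hh, rfl⟩ := exists_orthogonal_diagonalization hH
  simp only [conj_diagonal_pow hV, trace_conj_diagonal hV]
  exact sum_pow_mul_sum_pow_le hh i j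

theorem trace_resolvent_pow_mul_trace_le (hH : H.PosSemidef) {τ : ℝ} (hτ : 0 < τ) (i j : ℕ) :
    (resolvent τ H ^ i).trace * (resolvent τ H ^ j).trace
      ≤ r * (resolvent τ H ^ (i + j)).trace := by
  obtain ⟨V, h, hV, hh, rfl⟩ := exists_orthogonal_diagonalization hH
  simp only [resolvent_conj_diagonal hV hh hτ, conj_diagonal_pow hV, trace_conj_diagonal hV]
  exact sum_pow_mul_sum_pow_le (fun a => inv_nonneg.2 (by linarith [hh a])) i j

theorem trace_resolvent_pow_nonneg (hH : H.PosSemidef) {τ : ℝ} (hτ : 0 < τ) (k : ℕ) :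
    0 ≤ (resolvent τ H ^ k).trace := by
  obtain ⟨V, h, hV, hh, rfl⟩ := exists_orthogonal_diagonalization hH
  simp only [resolvent_conj_diagonal hV hh hτ, conj_diagonal_pow hV, trace_conj_diagonal hV]
  exact Finset.sum_nonneg fun i _ => pow_nonneg (inv_nonneg.2 (by linarith [hh i])) k

theorem trace_resolvent_pow_succ_mul_le (hH : H.PosSemidef) {τ : ℝ} (hτ : 0 < τ) (k : ℕ) :
    (resolvent τ H ^ (k + 1) * H).trace ≤ (resolvent τ H ^ k).trace := by
  obtain ⟨V, h, hV, hh, rfl⟩ := exists_orthogonal_diagonalization hH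
  simp only [resolvent_conj_diagonal hV hh hτ, conj_diagonal_pow hV, conj_diagonal_mul hV,
    trace_conj_diagonal hV]
  refine Finset.sum_le_sum fun i _ => ?_
  have h1 : 0 < h i + τ := by linarith [hh i]
  rw [pow_succ, mul_assoc]
  refine mul_le_of_le_one_right (by positivity) ?_
  rw [inv_mul_le_iff₀ h1]
  linarith

/-- Uniform bound on the entries of the resolvent, through its Frobenius norm. -/
theorem abs_resolvent_apply_le (hH : H.PosSemidef) {τ : ℝ} (hτ : 0 < τ) (i j : Fin r) :
    |resolvent τ H i j| ≤ √(r * (τ⁻¹) ^ 2) := by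
  have htr : (resolvent τ H ^ 2).trace ≤ r * (τ⁻¹) ^ 2 := by
    obtain ⟨V, h, hV, hh, rfl⟩ := exists_orthogonal_diagonalization hH
    simp only [resolvent_conj_diagonal hV hh hτ, conj_diagonal_pow hV, trace_conj_diagonal hV]
    calc ∑ i, ((h i + τ)⁻¹) ^ 2 ≤ ∑ _i : Fin r, (τ⁻¹) ^ 2 := by
          refine Finset.sum_le_sum fun i _ => ?_
          have := hh i
          have h1 : 0 < h i + τ := by linarith
          gcongr
          linarith
      _ = _ := by simp
  refine Real.le_sqrt_of_sq_le ?_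
  rw [sq_abs]
  refine le_trans ?_ htr
  have h2 : (resolvent τ H ^ 2).trace = ∑ a, ∑ b, resolvent τ H a b ^ 2 := by
    have hsymm := resolvent_transpose hH τ
    rw [sq]
    conv_lhs => rw [← hsymm]
    simp only [sq]
    rw [← matInner_eq_sum, matInner]
    rw [hsymm]
  rw [h2]
  refine le_trans ?_ (Finset.single_le_sum (f := fun a => ∑ b, resolvent τ H a b ^ 2)
    (fun a _ => by positivity) (Finset.mem_univ i))
  exact Finset.single_le_sum (f := fun b => resolvent τ H i b ^ 2)
    (fun a _ => by positivity) (Finset.mem_univ j)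

end Spectral

/-! ### Trace moments of Gaussian Gram matrices -/

section Moments

variable {d m r : ℕ}

/-- The matrix with entries `x (a, b)`. -/
def toMat (x : Fin d × Fin m → ℝ) : Matrix (Fin d) (Fin m) ℝ :=
  Matrix.of fun a b => x (a, b)

/-- The compression `Uᵀ x xᵀ U` of `x xᵀ` to the column space of `U`. -/
def compression (U : Matrix (Fin d) (Fin r) ℝ) (x : Fin d × Fin m → ℝ) :
    Matrix (Fin r) (Fin r) ℝ :=
  Uᵀ * toMat x * (Uᵀ * toMat x)ᵀ

theorem compression_posSemidef (U : Matrix (Fin d) (Fin r) ℝ) (x : Fin d × Fin m → ℝ) :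
    (compression U x).PosSemidef := by
  have := posSemidef_self_mul_conjTranspose (Uᵀ * toMat x)
  rwa [conjTranspose_eq_transpose_of_trivial] at this

/-- A matrix-valued function whose entries are continuous and of polynomial growth. -/
def MatPolyGrowth {p q : ℕ} (Y : (Fin d × Fin m → ℝ) → Matrix (Fin p) (Fin q) ℝ) : Prop :=
  ∀ i j, PolyGrowth fun x => Y x i j

namespace MatPolyGrowth

variable {p q s : ℕ}

theorem const (B : Matrix (Fin p) (Fin q) ℝ) :
    MatPolyGrowth fun _ : Fin d × Fin m → ℝ => B :=
  fun i j => PolyGrowth.const (B i j)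

theorem toMat : MatPolyGrowth (toMat : (Fin d × Fin m → ℝ) → _) :=
  fun i j => PolyGrowth.coord (i, j)

theorem mul {Y : (Fin d × Fin m → ℝ) → Matrix (Fin p) (Fin q) ℝ}
    {Z : (Fin d × Fin m → ℝ) → Matrix (Fin q) (Fin s) ℝ} (hY : MatPolyGrowth Y)
    (hZ : MatPolyGrowth Z) : MatPolyGrowth fun x => Y x * Z x := fun i j => by
  simp only [Matrix.mul_apply]
  exact PolyGrowth.sum _ fun k => (hY i k).mul (hZ k j)

theorem pow {Y : (Fin d × Fin m → ℝ) → Matrix (Fin p) (Fin p) ℝ} (hY : MatPolyGrowth Y) (k : ℕ) :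
    MatPolyGrowth fun x => Y x ^ k := by
  induction k with
  | zero => simpa using const 1
  | succ k ih => simpa only [pow_succ] using ih.mul hY

theorem transpose {Y : (Fin d × Fin m → ℝ) → Matrix (Fin p) (Fin q) ℝ} (hY : MatPolyGrowth Y) :
    MatPolyGrowth fun x => (Y x)ᵀ := fun i j => hY j i

theorem add {Y Z : (Fin d × Fin m → ℝ) → Matrix (Fin p) (Fin q) ℝ} (hY : MatPolyGrowth Y)
    (hZ : MatPolyGrowth Z) : MatPolyGrowth fun x => Y x + Z x := fun i j => (hY i j).add (hZ i j)

theorem sum {κ : Type*} (t : Finset κ) {Y : κ → (Fin d × Fin m → ℝ) → Matrix (Fin p) (Fin q) ℝ}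
    (hY : ∀ k, MatPolyGrowth (Y k)) : MatPolyGrowth fun x => ∑ k ∈ t, Y k x := fun i j => by
  simp only [Matrix.sum_apply]
  exact PolyGrowth.sum _ fun k => hY k i j

theorem smul {Y : (Fin d × Fin m → ℝ) → Matrix (Fin p) (Fin q) ℝ} (hY : MatPolyGrowth Y)
    (c : ℝ) : MatPolyGrowth fun x => c • Y x := fun i j => (PolyGrowth.const c).mul (hY i j)

theorem trace {Y : (Fin d × Fin m → ℝ) → Matrix (Fin p) (Fin p) ℝ} (hY : MatPolyGrowth Y) :
    PolyGrowth fun x => (Y x).trace :=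
  PolyGrowth.sum _ fun i => hY i i

theorem continuous {Y : (Fin d × Fin m → ℝ) → Matrix (Fin p) (Fin q) ℝ} (hY : MatPolyGrowth Y) :
    Continuous Y := continuous_matrix fun i j => (hY i j).1

theorem compression (U : Matrix (Fin d) (Fin r) ℝ) :
    MatPolyGrowth (compression U : (Fin d × Fin m → ℝ) → _) :=
  ((const Uᵀ).mul toMat).mul ((const Uᵀ).mul toMat).transpose

theorem resolvent (U : Matrix (Fin d) (Fin r) ℝ) {τ : ℝ} (hτ : 0 < τ) :
    MatPolyGrowth fun x : Fin d × Fin m → ℝ => resolvent τ (DualRP.compression U x) := fun i j => by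
  refine PolyGrowth.of_bounded ?_ fun x =>
    abs_resolvent_apply_le (compression_posSemidef U x) hτ i j
  have hc : Continuous fun x : Fin d × Fin m → ℝ => DualRP.compression U x + τ • 1 :=
    (compression U).continuous.add continuous_const
  have hdet : ∀ x : Fin d × Fin m → ℝ, (DualRP.compression U x + τ • 1).det ≠ 0 := fun x =>
    ((Matrix.isUnit_iff_isUnit_det _).1
      (isUnit_add_smul_one (compression_posSemidef U x) hτ)).ne_zero
  simp only [DualRP.resolvent, Matrix.inv_def, Ring.inverse_eq_inv', Matrix.smul_apply, smul_eq_mul]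
  exact (hc.matrix_det.inv₀ hdet).mul (hc.matrix_adjugate.matrix_elem i j)

end MatPolyGrowth

theorem mul_single_mul_apply {p q s t : ℕ} (B : Matrix (Fin p) (Fin q) ℝ)
    (C : Matrix (Fin s) (Fin t) ℝ) (a : Fin q) (b : Fin s) (k : Fin p) (l : Fin t) :
    (B * single a b (1 : ℝ) * C) k l = B k a * C b l := by
  rw [Matrix.mul_apply, Finset.sum_eq_single b]
  · rw [mul_single_apply_same, mul_one]
  · intro c _ hc
    rw [mul_single_apply_of_ne (hbj := hc), zero_mul]
  · simp

theorem toMat_update (x : Fin d × Fin m → ℝ) (a : Fin d) (b : Fin m) (t : ℝ) :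
    toMat (Function.update x (a, b) t) = toMat x + (t - x (a, b)) • single a b (1 : ℝ) := by
  ext i j
  by_cases h : (i, j) = (a, b)
  · obtain ⟨rfl, rfl⟩ := Prod.mk.inj h
    simp [toMat]
  · have h' : ¬(a = i ∧ b = j) := fun hc => h (by rw [hc.1, hc.2])
    simp [toMat, Function.update_of_ne h, h']

/-- The derivative of `compression U x` along the coordinate `(a, b)`. -/
def compressionDeriv (U : Matrix (Fin d) (Fin r) ℝ) (x : Fin d × Fin m → ℝ) (a : Fin d)
    (b : Fin m) : Matrix (Fin r) (Fin r) ℝ :=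
  Uᵀ * single a b (1 : ℝ) * (Uᵀ * toMat x)ᵀ + Uᵀ * toMat x * (Uᵀ * single a b (1 : ℝ))ᵀ

theorem hasDerivAt_compression (U : Matrix (Fin d) (Fin r) ℝ) (x : Fin d × Fin m → ℝ) (a : Fin d)
    (b : Fin m) :
    HasDerivAt (fun t => compression U (Function.update x (a, b) t))
      (compressionDeriv U x a b) (x (a, b)) := by
  have hexp : (fun t => compression U (Function.update x (a, b) t)) = fun t =>
      compression U x + (t - x (a, b)) • compressionDeriv U x a b
        + (t - x (a, b)) ^ 2 • (Uᵀ * single a b (1 : ℝ) * (Uᵀ * single a b (1 : ℝ))ᵀ) := by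
    funext t
    simp only [compression, compressionDeriv, toMat_update, Matrix.mul_add, Matrix.mul_smul,
      transpose_add, transpose_smul, Matrix.add_mul, Matrix.smul_mul, smul_add, smul_smul, sq]
    abel
  rw [hexp]
  have h1 : HasDerivAt (fun t : ℝ => t - x (a, b)) 1 (x (a, b)) :=
    (hasDerivAt_id _).sub_const _
  have h2 := ((h1.smul_const (compressionDeriv U x a b)).const_add (compression U x)).add
    ((h1.pow 2).smul_const (Uᵀ * single a b (1 : ℝ) * (Uᵀ * single a b (1 : ℝ))ᵀ))
  refine h2.congr_deriv ?_
  simp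

/-- Gaussian integration by parts for the trace of `f * compression U`, for a matrix-valued
function `f` whose derivative along each coordinate is obtained from that of `compression U` by
multiplication with matrices from the left and from the right. -/
theorem integral_trace_mul_compression {U : Matrix (Fin d) (Fin r) ℝ} (hU : Uᵀ * U = 1)
    {v : ℝ≥0} (hv : v ≠ 0) {f : (Fin d × Fin m → ℝ) → Matrix (Fin r) (Fin r) ℝ}
    (hf : MatPolyGrowth f) (n : ℕ) (σ : ℝ)
    {P Q : ℕ → (Fin d × Fin m → ℝ) → Matrix (Fin r) (Fin r) ℝ} (hP : ∀ j, MatPolyGrowth (P j))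
    (hQ : ∀ j, MatPolyGrowth (Q j)) (hPT : ∀ j x, (P j x)ᵀ = P j x)
    (hder : ∀ x a b, HasDerivAt (fun t => f (Function.update x (a, b) t))
      (σ • ∑ j ∈ Finset.range n, P j x * compressionDeriv U x a b * Q j x) (x (a, b))) :
    ∫ x, (f x * compression U x).trace ∂(Measure.pi fun _ => gaussianReal 0 v)
      = v * ∫ x, (m * (f x).trace + σ * ∑ j ∈ Finset.range n,
          ((P j x).trace * (Q j x * compression U x).trace
            + (P j x * Q j x * compression U x).trace))
        ∂(Measure.pi fun _ => gaussianReal 0 v) := by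
  set D : Fin d × Fin m → (Fin d × Fin m → ℝ) → Matrix (Fin d) (Fin m) ℝ := fun c x =>
    U * ((σ • ∑ j ∈ Finset.range n, P j x * compressionDeriv U x c.1 c.2 * Q j x)
      * (Uᵀ * toMat x) + f x * (Uᵀ * single c.1 c.2 (1 : ℝ))) with hD
  have hG : MatPolyGrowth fun x : Fin d × Fin m → ℝ => Uᵀ * toMat x :=
    (MatPolyGrowth.const Uᵀ).mul MatPolyGrowth.toMat
  have hF : MatPolyGrowth fun x => U * (f x * (Uᵀ * toMat x)) :=
    (MatPolyGrowth.const U).mul (hf.mul hG)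
  have hDp : ∀ c, MatPolyGrowth (D c) := fun c =>
    (MatPolyGrowth.const U).mul (((MatPolyGrowth.smul (MatPolyGrowth.sum _ fun j =>
      ((hP j).mul (((MatPolyGrowth.const _).mul hG.transpose).add
        (hG.mul (MatPolyGrowth.const _)))).mul (hQ j)) σ).mul hG).add
          (hf.mul (MatPolyGrowth.const _)))
  have hcoord : ∀ c : Fin d × Fin m,
      ∫ x, x c * (U * (f x * (Uᵀ * toMat x))) c.1 c.2 ∂(Measure.pi fun _ => gaussianReal 0 v)
        = v * ∫ x, D c x c.1 c.2 ∂(Measure.pi fun _ => gaussianReal 0 v) := fun c => by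
    refine integral_coord_mul hv c (fun x => ?_) ((hF c.1 c.2).integrable v)
      ((hDp c c.1 c.2).integrable v) (((PolyGrowth.coord c).mul (hF c.1 c.2)).integrable v)
    obtain ⟨a, b⟩ := c
    have h1 : HasDerivAt (fun t => toMat (Function.update x (a, b) t))
        (single a b (1 : ℝ) : Matrix (Fin d) (Fin m) ℝ) (x (a, b)) := by
      simp only [toMat_update]
      have h1 : HasDerivAt (fun t : ℝ => t - x (a, b)) 1 (x (a, b)) :=
        (hasDerivAt_id _).sub_const _
      exact ((h1.smul_const (single a b (1 : ℝ))).const_add (toMat x)).congr_deriv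
        (one_smul ℝ _)
    have hfe : ∀ k l, HasDerivAt (fun t => f (Function.update x (a, b) t) k l) _ (x (a, b)) :=
      fun k l => hasDerivAt_pi.1 (hasDerivAt_pi.1 (hder x a b) k) l
    have hGe : ∀ l, HasDerivAt (fun t => (Uᵀ * toMat (Function.update x (a, b) t)) l b)
        ((Uᵀ * single a b (1 : ℝ) : Matrix (Fin r) (Fin m) ℝ) l b) (x (a, b)) := fun l => by
      simp only [Matrix.mul_apply]
      exact HasDerivAt.fun_sum fun i _ =>
        (hasDerivAt_pi.1 (hasDerivAt_pi.1 h1 i) b).const_mul (Uᵀ l i)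
    have h2 := HasDerivAt.fun_sum (u := Finset.univ) fun k _ => (HasDerivAt.fun_sum
      (u := Finset.univ) fun l _ => (hfe k l).fun_mul (hGe l)).const_mul (U a k)
    have hfun : (fun t => (U * (f (Function.update x (a, b) t)
        * (Uᵀ * toMat (Function.update x (a, b) t)))) a b) = fun t => ∑ k, U a k *
          ∑ l, f (Function.update x (a, b) t) k l
            * (Uᵀ * toMat (Function.update x (a, b) t)) l b := by
      funext t
      rw [Matrix.mul_apply]
      exact Finset.sum_congr rfl fun k _ => by rw [Matrix.mul_apply]
    change HasDerivAt (fun t => (U * (f (Function.update x (a, b) t)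
        * (Uᵀ * toMat (Function.update x (a, b) t)))) a b) (D (a, b) x a b) (x (a, b))
    rw [hfun]
    refine h2.congr_deriv ?_
    simp only [hD, Function.update_eq_self]
    rw [Matrix.mul_apply]
    refine Finset.sum_congr rfl fun k _ => ?_
    rw [Matrix.add_apply, Matrix.mul_apply, Matrix.mul_apply, ← Finset.sum_add_distrib]
  have hlhs : ∀ x, (f x * compression U x).trace
      = ∑ c : Fin d × Fin m, x c * (U * (f x * (Uᵀ * toMat x))) c.1 c.2 := fun x => by
    have h1 : ∑ c : Fin d × Fin m, x c * (U * (f x * (Uᵀ * toMat x))) c.1 c.2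
        = matInner (toMat x) (U * (f x * (Uᵀ * toMat x))) := by
      rw [matInner_eq_sum, Fintype.sum_prod_type]
      rfl
    rw [h1, matInner, compression, ← Matrix.mul_assoc, Matrix.trace_mul_comm, transpose_mul,
      transpose_transpose, Matrix.mul_assoc]
  have hrhs : ∀ x, ∑ c : Fin d × Fin m, D c x c.1 c.2
      = m * (f x).trace + σ * ∑ j ∈ Finset.range n,
          ((P j x).trace * (Q j x * compression U x).trace
            + (P j x * Q j x * compression U x).trace) := fun x => by
    have hcyc : ∀ B : Matrix (Fin r) (Fin r) ℝ, ∑ a, (U * B * Uᵀ) a a = B.trace := fun B => by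
      change (U * B * Uᵀ).trace = _
      rw [Matrix.trace_mul_comm, ← Matrix.mul_assoc, hU, Matrix.one_mul]
    have hsplit : ∀ c : Fin d × Fin m, D c x c.1 c.2
        = (U * f x * Uᵀ) c.1 c.1 + σ * ∑ j ∈ Finset.range n,
          ((U * P j x * Uᵀ) c.1 c.1 * ((Uᵀ * toMat x)ᵀ * (Q j x * (Uᵀ * toMat x))) c.2 c.2
            + (U * (P j x * (Uᵀ * toMat x))) c.1 c.2
              * (U * (Q j x * (Uᵀ * toMat x))) c.1 c.2) := fun c => by
      have e1 : U * (f x * (Uᵀ * single c.1 c.2 (1 : ℝ)))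
          = U * f x * Uᵀ * single c.1 c.2 (1 : ℝ) * (1 : Matrix (Fin m) (Fin m) ℝ) := by
        simp only [Matrix.mul_assoc, Matrix.mul_one]
      have e2 : ∀ j, U * (P j x * compressionDeriv U x c.1 c.2 * Q j x * (Uᵀ * toMat x))
          = U * P j x * Uᵀ * single c.1 c.2 (1 : ℝ) * ((Uᵀ * toMat x)ᵀ * (Q j x * (Uᵀ * toMat x)))
            + U * (P j x * (Uᵀ * toMat x)) * single c.2 c.1 (1 : ℝ)
              * (U * (Q j x * (Uᵀ * toMat x))) := fun j => by
        simp only [compressionDeriv, transpose_mul, transpose_transpose, transpose_single,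
          Matrix.mul_add, Matrix.add_mul, Matrix.mul_assoc]
      simp only [hD]
      rw [Matrix.mul_add, Matrix.add_apply, e1, mul_single_mul_apply, Matrix.one_apply_eq, mul_one,
        add_comm, Matrix.smul_mul, Matrix.mul_smul, Matrix.smul_apply, smul_eq_mul, Matrix.sum_mul,
        Matrix.mul_sum, Matrix.sum_apply]
      simp only [e2, Matrix.add_apply, mul_single_mul_apply]
    simp only [hsplit]
    rw [Finset.sum_add_distrib, ← Finset.mul_sum, Finset.sum_comm]
    congr 1
    · rw [Fintype.sum_prod_type]
      simp only [Finset.sum_const, Finset.card_univ, Fintype.card_fin, nsmul_eq_mul]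
      rw [← Finset.mul_sum, hcyc]
    · congr 1
      refine Finset.sum_congr rfl fun j _ => ?_
      rw [Finset.sum_add_distrib]
      congr 1
      · rw [Fintype.sum_prod_type, ← hcyc (P j x), Finset.sum_mul]
        refine Finset.sum_congr rfl fun a _ => ?_
        change ∑ b, (U * P j x * Uᵀ) a a * ((Uᵀ * toMat x)ᵀ * (Q j x * (Uᵀ * toMat x))) b b = _
        rw [← Finset.mul_sum]
        congr 1
        change ((Uᵀ * toMat x)ᵀ * (Q j x * (Uᵀ * toMat x))).trace = _
        rw [Matrix.trace_mul_comm, compression, Matrix.mul_assoc]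
      · rw [Fintype.sum_prod_type]
        have := matInner_eq_sum (U * (P j x * (Uᵀ * toMat x))) (U * (Q j x * (Uᵀ * toMat x)))
        rw [← this, matInner, transpose_mul, Matrix.mul_assoc, ← Matrix.mul_assoc Uᵀ U, hU,
          Matrix.one_mul, transpose_mul, hPT, Matrix.mul_assoc, Matrix.trace_mul_comm, compression]
        simp only [Matrix.mul_assoc]
  simp only [hlhs]
  rw [integral_finsetSum _ fun c _ => ((PolyGrowth.coord c).mul (hF c.1 c.2)).integrable v]
  simp only [hcoord]
  rw [← Finset.mul_sum, ← integral_finsetSum _ fun c _ => (hDp c c.1 c.2).integrable v]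
  simp only [hrhs]

/-- Integration by parts with `f = H ^ k` produces `k` terms `tr Hⁱ tr Hᵏ⁻ⁱ + tr Hᵏ`, each at most
`(r + 1) tr Hᵏ`. -/
theorem integral_trace_compression_pow_succ_le {U : Matrix (Fin d) (Fin r) ℝ} (hU : Uᵀ * U = 1)
    (hm : m ≠ 0) (k : ℕ) :
    ∫ x : Fin d × Fin m → ℝ, (compression U x ^ (k + 1)).trace
        ∂(Measure.pi fun _ => gaussianReal 0 ((m : ℝ≥0)⁻¹))
      ≤ (1 + k / (m / (r + 1))) * ∫ x : Fin d × Fin m → ℝ, (compression U x ^ k).trace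
        ∂(Measure.pi fun _ => gaussianReal 0 ((m : ℝ≥0)⁻¹)) := by
  have hm' : (m : ℝ) ≠ 0 := by exact_mod_cast hm
  have hv : ((m : ℝ≥0)⁻¹) ≠ 0 := inv_ne_zero (by exact_mod_cast hm)
  have hW := MatPolyGrowth.compression (m := m) U
  have h := integral_trace_mul_compression hU hv (hW.pow k) k 1
    (P := fun j x => compression U x ^ (k.pred - j)) (Q := fun j x => compression U x ^ j)
    (fun j => hW.pow _) (fun j => hW.pow j)
    (fun j x => by
      have h1 : (compression U x)ᵀ = compression U x := (compression_posSemidef U x).isHermitian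
      rw [transpose_pow, h1])
    (fun x a b => by
      refine ((hasDerivAt_compression U x a b).fun_pow' k).congr_deriv ?_
      rw [Function.update_eq_self, one_smul])
  simp only [← pow_succ] at h
  rw [h]
  have hI : Integrable (fun x : Fin d × Fin m → ℝ => (compression U x ^ k).trace)
      (Measure.pi fun _ => gaussianReal 0 ((m : ℝ≥0)⁻¹)) := (hW.pow k).trace.integrable _
  have hle : ∀ x : Fin d × Fin m → ℝ, m * (compression U x ^ k).trace
      + 1 * ∑ j ∈ Finset.range k, ((compression U x ^ (k.pred - j)).trace
        * (compression U x ^ (j + 1)).trace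
        + (compression U x ^ (k.pred - j) * compression U x ^ j * compression U x).trace)
      ≤ (m + k * (r + 1)) * (compression U x ^ k).trace := fun x => by
    have hterm : ∀ j ∈ Finset.range k, (compression U x ^ (k.pred - j)).trace
        * (compression U x ^ (j + 1)).trace
        + (compression U x ^ (k.pred - j) * compression U x ^ j * compression U x).trace
        ≤ (r + 1) * (compression U x ^ k).trace := fun j hj => by
      have hj' := Finset.mem_range.1 hj
      have e : k.pred - j + (j + 1) = k := by rw [Nat.pred_eq_sub_one]; omega
      have h1 := trace_pow_mul_trace_pow_le (compression_posSemidef U x) (k.pred - j) (j + 1)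
      rw [e] at h1
      rw [mul_assoc, ← pow_succ, ← pow_add, e]
      linarith
    have := Finset.sum_le_sum hterm
    rw [Finset.sum_const, Finset.card_range, nsmul_eq_mul] at this
    linarith
  have hint := integral_mono_of_nonneg (μ := Measure.pi fun _ => gaussianReal 0 ((m : ℝ≥0)⁻¹))
    (Filter.Eventually.of_forall fun x => ?_) (hI.const_mul (m + k * (r + 1) : ℝ))
    (Filter.Eventually.of_forall hle)
  · rw [integral_const_mul] at hint
    calc _ ≤ (((m : ℝ≥0)⁻¹ : ℝ≥0) : ℝ) * _ := mul_le_mul_of_nonneg_left hint (by positivity)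
      _ = _ := by
        push_cast
        rw [← mul_assoc]
        congr 1
        field_simp
  · have hps := compression_posSemidef U x
    refine add_nonneg (mul_nonneg (by positivity) (trace_pow_nonneg hps k)) ?_
    rw [one_mul]
    refine Finset.sum_nonneg fun j _ => add_nonneg
      (mul_nonneg (trace_pow_nonneg hps _) (trace_pow_nonneg hps _)) ?_
    rw [mul_assoc, ← pow_succ, ← pow_add]
    exact trace_pow_nonneg hps _

/-- Integration by parts with `f = X ^ (p + 1)`, where `X` is the resolvent, produces `p + 1` terms of
negative sign; since `X H ≤ 1`, each is at most `(r + 1) tr Xᵖ⁺¹` in absolute value. The shift by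
`τ` keeps all functions bounded, so that no inverse moments of a nearly singular matrix occur. -/
theorem integral_trace_resolvent_pow_succ_le {U : Matrix (Fin d) (Fin r) ℝ} (hU : Uᵀ * U = 1)
    (hm : m ≠ 0) {τ : ℝ} (hτ : 0 < τ) (p : ℕ) :
    (1 - ((p + 1 : ℕ) : ℝ) / (m / (r + 1)))
        * ∫ x : Fin d × Fin m → ℝ, (resolvent τ (compression U x) ^ (p + 1)).trace
          ∂(Measure.pi fun _ => gaussianReal 0 ((m : ℝ≥0)⁻¹))
      ≤ ∫ x : Fin d × Fin m → ℝ, (resolvent τ (compression U x) ^ p).trace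
        ∂(Measure.pi fun _ => gaussianReal 0 ((m : ℝ≥0)⁻¹)) := by
  have hm' : (m : ℝ) ≠ 0 := by exact_mod_cast hm
  have hv : ((m : ℝ≥0)⁻¹) ≠ 0 := inv_ne_zero (by exact_mod_cast hm)
  have hX := MatPolyGrowth.resolvent (m := m) U hτ
  have hW := MatPolyGrowth.compression (m := m) U
  have hderX : ∀ (x : Fin d × Fin m → ℝ) a b,
      HasDerivAt (fun t => resolvent τ (compression U (Function.update x (a, b) t)))
        (-(resolvent τ (compression U x) * compressionDeriv U x a b
          * resolvent τ (compression U x))) (x (a, b)) := fun x a b => by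
    have hunit : IsUnit (compression U (Function.update x (a, b) (x (a, b))) + τ • 1) :=
      isUnit_add_smul_one (compression_posSemidef U _) hτ
    have h1 := (hasDerivAt_compression U x a b).add_const (τ • (1 : Matrix (Fin r) (Fin r) ℝ))
    have h2 := hasFDerivAt_ringInverse (𝕜 := ℝ) hunit.unit
    have h3 : ((hunit.unit⁻¹ : (Matrix (Fin r) (Fin r) ℝ)ˣ) : Matrix (Fin r) (Fin r) ℝ)
        = resolvent τ (compression U x) := by
      rw [resolvent, nonsing_inv_eq_ringInverse, ← Ring.inverse_unit, IsUnit.unit_spec,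
        Function.update_eq_self]
    rw [h3, IsUnit.unit_spec] at h2
    have h5 := h2.comp_hasDerivAt (x (a, b)) h1
    simp only [resolvent, nonsing_inv_eq_ringInverse] at h5 ⊢
    exact h5.congr_deriv (by simp)
  have h := integral_trace_mul_compression hU hv (hX.pow (p + 1)) (p + 1) (-1)
    (P := fun j x => resolvent τ (compression U x) ^ (p - j) * resolvent τ (compression U x))
    (Q := fun j x => resolvent τ (compression U x) * resolvent τ (compression U x) ^ j)
    (fun j => (hX.pow _).mul hX) (fun j => hX.mul (hX.pow j))
    (fun j x => by
      rw [← pow_succ, transpose_pow, resolvent_transpose (compression_posSemidef U x)])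
    (fun x a b => by
      refine ((hderX x a b).fun_pow' (p + 1)).congr_deriv ?_
      rw [Function.update_eq_self, neg_one_smul, ← Finset.sum_neg_distrib]
      refine Finset.sum_congr rfl fun j _ => ?_
      simp only [Nat.pred_succ, Matrix.mul_neg, Matrix.neg_mul, Matrix.mul_assoc])
  simp only [← pow_succ, ← pow_succ'] at h
  have hI : ∀ q, Integrable (fun x : Fin d × Fin m → ℝ => (resolvent τ (compression U x) ^ q).trace)
      (Measure.pi fun _ => gaussianReal 0 ((m : ℝ≥0)⁻¹)) := fun q => (hX.pow q).trace.integrable _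
  have hle : ∀ x : Fin d × Fin m → ℝ, (m - (p + 1 : ℕ) * (r + 1))
        * (resolvent τ (compression U x) ^ (p + 1)).trace
      ≤ m * (resolvent τ (compression U x) ^ (p + 1)).trace
      + -1 * ∑ j ∈ Finset.range (p + 1), ((resolvent τ (compression U x) ^ (p - j + 1)).trace
        * (resolvent τ (compression U x) ^ (j + 1) * compression U x).trace
        + (resolvent τ (compression U x) ^ (p - j + 1) * resolvent τ (compression U x) ^ (j + 1)
          * compression U x).trace) := fun x => by
    have hps := compression_posSemidef U x
    have hterm : ∀ j ∈ Finset.range (p + 1), (resolvent τ (compression U x) ^ (p - j + 1)).trace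
        * (resolvent τ (compression U x) ^ (j + 1) * compression U x).trace
        + (resolvent τ (compression U x) ^ (p - j + 1) * resolvent τ (compression U x) ^ (j + 1)
          * compression U x).trace
        ≤ (r + 1) * (resolvent τ (compression U x) ^ (p + 1)).trace := fun j hj => by
      have hj' := Finset.mem_range.1 hj
      have e : p - j + 1 + (j + 1) = p + 1 + 1 := by omega
      have e' : p - j + 1 + j = p + 1 := by omega
      have h1 := mul_le_mul_of_nonneg_left (trace_resolvent_pow_succ_mul_le hps hτ j)
        (trace_resolvent_pow_nonneg hps hτ (p - j + 1))
      have h2 := trace_resolvent_pow_mul_trace_le hps hτ (p - j + 1) j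
      rw [e'] at h2
      rw [← pow_add, e]
      linarith [trace_resolvent_pow_succ_mul_le hps hτ (p + 1)]
    have := Finset.sum_le_sum hterm
    rw [Finset.sum_const, Finset.card_range, nsmul_eq_mul] at this
    linarith
  have hrhs : Integrable (fun x : Fin d × Fin m → ℝ =>
      m * (resolvent τ (compression U x) ^ (p + 1)).trace
      + -1 * ∑ j ∈ Finset.range (p + 1), ((resolvent τ (compression U x) ^ (p - j + 1)).trace
        * (resolvent τ (compression U x) ^ (j + 1) * compression U x).trace
        + (resolvent τ (compression U x) ^ (p - j + 1) * resolvent τ (compression U x) ^ (j + 1)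
          * compression U x).trace)) (Measure.pi fun _ => gaussianReal 0 ((m : ℝ≥0)⁻¹)) :=
    (((PolyGrowth.const _).mul (hX.pow _).trace).add ((PolyGrowth.const _).mul
      (PolyGrowth.sum _ fun j => (((hX.pow _).trace.mul ((hX.pow _).mul hW).trace).add
        (((hX.pow _).mul (hX.pow _)).mul hW).trace)))).integrable _
  have hint := integral_mono ((hI (p + 1)).const_mul _) hrhs hle
  have hfin : ∫ x : Fin d × Fin m → ℝ, (resolvent τ (compression U x) ^ (p + 1)
      * compression U x).trace ∂(Measure.pi fun _ => gaussianReal 0 ((m : ℝ≥0)⁻¹))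
      ≤ ∫ x : Fin d × Fin m → ℝ, (resolvent τ (compression U x) ^ p).trace
        ∂(Measure.pi fun _ => gaussianReal 0 ((m : ℝ≥0)⁻¹)) :=
    integral_mono (((hX.pow _).mul hW).trace.integrable _) (hI p) fun x =>
      trace_resolvent_pow_succ_mul_le (compression_posSemidef U x) hτ p
  rw [integral_const_mul] at hint
  refine le_trans ?_ hfin
  rw [h]
  calc _ = (((m : ℝ≥0)⁻¹ : ℝ≥0) : ℝ) * ((m - (p + 1 : ℕ) * (r + 1)) * _) := by
        push_cast
        rw [← mul_assoc]
        congr 1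
        field_simp
    _ ≤ _ := mul_le_mul_of_nonneg_left hint (by positivity)

theorem integral_trace_compression_pow_le {U : Matrix (Fin d) (Fin r) ℝ} (hU : Uᵀ * U = 1)
    (hm : m ≠ 0) (k : ℕ) :
    ∫ x : Fin d × Fin m → ℝ, (compression U x ^ k).trace
        ∂(Measure.pi fun _ => gaussianReal 0 ((m : ℝ≥0)⁻¹))
      ≤ r * Real.exp (k * (k - 1) / (2 * (m / (r + 1)))) := by
  induction k with
  | zero => simp
  | succ k ih =>
    refine (integral_trace_compression_pow_succ_le hU hm k).trans ?_
    have hμ : (0 : ℝ) < m / (r + 1) := by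
      have : (0 : ℝ) < m := by exact_mod_cast Nat.pos_of_ne_zero hm
      positivity
    set μ : ℝ := m / (r + 1)
    have h1 : 1 + k / μ ≤ Real.exp (k / μ) := by linarith [Real.add_one_le_exp ((k : ℝ) / μ)]
    calc _ ≤ Real.exp (k / μ) * (r * Real.exp (k * (k - 1) / (2 * μ))) := by
          refine mul_le_mul h1 ih (integral_nonneg fun x =>
            trace_pow_nonneg (compression_posSemidef U x) k) (Real.exp_pos _).le
      _ = r * (Real.exp (k / μ) * Real.exp (k * (k - 1) / (2 * μ))) := by ring
      _ = _ := by
        rw [← Real.exp_add]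
        congr 2
        push_cast
        field_simp
        ring

theorem integral_trace_resolvent_pow_le {U : Matrix (Fin d) (Fin r) ℝ} (hU : Uᵀ * U = 1)
    (hm : m ≠ 0) {τ : ℝ} (hτ : 0 < τ) (p : ℕ) (hp : (p : ℝ) / (m / (r + 1)) ≤ 1 / 5) :
    ∫ x : Fin d × Fin m → ℝ, (resolvent τ (compression U x) ^ p).trace
        ∂(Measure.pi fun _ => gaussianReal 0 ((m : ℝ≥0)⁻¹))
      ≤ r * Real.exp (5 / 4 * (p * (p + 1) / (2 * (m / (r + 1))))) := by
  induction p with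
  | zero => simp
  | succ p ih =>
    have hμ : (0 : ℝ) < m / (r + 1) := by
      have : (0 : ℝ) < m := by exact_mod_cast Nat.pos_of_ne_zero hm
      positivity
    have h0 := integral_trace_resolvent_pow_succ_le hU hm hτ p
    set μ : ℝ := m / (r + 1)
    set y : ℝ := ((p + 1 : ℕ) : ℝ) / μ with hy
    have hy0 : 0 ≤ y := by positivity
    have ih' := ih (le_trans (by rw [hy]; gcongr; simp) hp)
    have hone : 1 ≤ Real.exp (5 / 4 * y) * (1 - y) := by
      have h1 : 1 + 5 / 4 * y ≤ Real.exp (5 / 4 * y) := by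
        linarith [Real.add_one_le_exp (5 / 4 * y)]
      calc (1 : ℝ) ≤ (1 + 5 / 4 * y) * (1 - y) := by nlinarith
        _ ≤ _ := mul_le_mul_of_nonneg_right h1 (by linarith)
    have hnn : 0 ≤ ∫ x : Fin d × Fin m → ℝ, (resolvent τ (compression U x) ^ (p + 1)).trace
        ∂(Measure.pi fun _ => gaussianReal 0 ((m : ℝ≥0)⁻¹)) :=
      integral_nonneg fun x => trace_resolvent_pow_nonneg (compression_posSemidef U x) hτ _
    calc _ ≤ Real.exp (5 / 4 * y) * (1 - y) * _ := le_mul_of_one_le_left hnn hone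
      _ = Real.exp (5 / 4 * y) * ((1 - y) * _) := mul_assoc _ _ _
      _ ≤ Real.exp (5 / 4 * y) * (r * Real.exp (5 / 4 * (p * (p + 1) / (2 * μ)))) :=
        mul_le_mul_of_nonneg_left (h0.trans ih') (Real.exp_pos _).le
      _ = r * (Real.exp (5 / 4 * y) * Real.exp (5 / 4 * (p * (p + 1) / (2 * μ)))) := by ring
      _ = _ := by
        rw [← Real.exp_add]
        congr 2
        rw [hy]
        push_cast
        field_simp
        ring

end Moments

/-! ### Concentration of the compressed Gram matrix -/

section Tail

variable {d m r : ℕ}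

/-- The exponents in the two Markov bounds, for `μ = m / (r + 1)` and `L = log (2 r / δ)`. -/
theorem exponent_bounds {ε μ L : ℝ} (hε : 0 < ε) (hε' : ε ≤ 1 / 6) (hL : 1 / 2 ≤ L)
    (h : 3 * L ≤ ε ^ 2 * μ) {k : ℕ} (hk : k = ⌈ε * μ⌉₊) :
    (k : ℝ) / μ ≤ 1 / 5 ∧ L + k * (k - 1) / (2 * μ) ≤ 12 / 13 * ε * k ∧
      L + 5 / 4 * (k * (k + 1) / (2 * μ)) ≤ 5 / 4 * ε * k := by
  have hμ : 0 < μ := by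
    by_contra! hc
    nlinarith [mul_nonneg (sq_nonneg ε) (neg_nonneg.2 hc)]
  have h9 : 9 ≤ ε * μ := by
    have : ε * (ε * μ) ≤ 1 / 6 * (ε * μ) := by gcongr
    nlinarith
  have h1 : ε * μ ≤ k := hk ▸ Nat.le_ceil _
  have h2 : (k : ℝ) < ε * μ + 1 := hk ▸ Nat.ceil_lt_add_one (by positivity)
  have hk0 : (0 : ℝ) < k := by linarith
  have h3 : 3 * L ≤ ε * k := by nlinarith
  refine ⟨?_, ?_, ?_⟩
  · rw [div_le_iff₀ hμ]
    nlinarith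
  · have : k * (k - 1) / (2 * μ) ≤ ε * k / 2 := by
      rw [div_le_div_iff₀ (by positivity) two_pos]
      nlinarith
    nlinarith
  · have : k * (k + 1) / (2 * μ) ≤ 11 / 18 * (ε * k) := by
      rw [div_le_iff₀ (by positivity)]
      nlinarith
    nlinarith

theorem exp_le_one_add {ε : ℝ} (hε : 0 < ε) (hε' : ε ≤ 1 / 6) :
    Real.exp (12 / 13 * ε) ≤ 1 + ε := by
  rw [← Real.le_log_iff_exp_le (by linarith)]
  refine le_trans ?_ (Real.le_log_one_add_of_nonneg hε.le)
  rw [le_div_iff₀ (by linarith)]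
  nlinarith

theorem exp_le_inv_one_sub {y : ℝ} (hy : y < 1) : Real.exp y ≤ (1 - y)⁻¹ := by
  rw [le_inv_comm₀ (Real.exp_pos _) (by linarith), ← Real.exp_neg]
  linarith [Real.add_one_le_exp (-y)]

/-- The points where the two trace moments that control the extreme eigenvalues of
`compression U x` stay below their typical size. -/
def goodSet (U : Matrix (Fin d) (Fin r) ℝ) (m k : ℕ) (ε : ℝ) : Set (Fin d × Fin m → ℝ) :=
  {x | (compression U x ^ k).trace < (1 + ε) ^ k ∧
    (resolvent (ε / 4) (compression U x) ^ k).trace < ((1 - 5 / 4 * ε)⁻¹) ^ k}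

theorem measurableSet_goodSet (U : Matrix (Fin d) (Fin r) ℝ) (k : ℕ) {ε : ℝ} (hε : 0 < ε) :
    MeasurableSet (goodSet U m k ε) := by
  have h1 := ((MatPolyGrowth.compression (m := m) U).pow k).trace.1
  have h2 := ((MatPolyGrowth.resolvent (m := m) U (show 0 < ε / 4 by linarith)).pow k).trace.1
  exact ((isOpen_lt h1 continuous_const).inter (isOpen_lt h2 continuous_const)).measurableSet

/-- A trace moment dominates the power of every single eigenvalue, so on `goodSet` the eigenvalues of
`compression U x` lie between `1 - 3ε/2` and `1 + ε`. -/
theorem abs_one_sub_mul_le_of_mem_goodSet {U : Matrix (Fin d) (Fin r) ℝ} {k : ℕ} {ε : ℝ}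
    (hε : 0 < ε) (hε' : ε ≤ 1 / 6) {x : Fin d × Fin m → ℝ} (hx : x ∈ goodSet U m k ε)
    {V : Matrix (Fin r) (Fin r) ℝ} {h : Fin r → ℝ} (hV : Vᵀ * V = 1) (hh : ∀ i, 0 ≤ h i)
    (hH : compression U x = V * diagonal h * Vᵀ) (a b : Fin r) : |1 - h a * h b| ≤ 3 * ε := by
  obtain ⟨h1, h2⟩ := hx
  rw [hH, conj_diagonal_pow hV, trace_conj_diagonal hV] at h1
  rw [hH, resolvent_conj_diagonal hV hh (by linarith), conj_diagonal_pow hV,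
    trace_conj_diagonal hV] at h2
  have hpos : ∀ i, 0 < h i + ε / 4 := fun i => by linarith [hh i]
  have hup : ∀ i, h i < 1 + ε := fun i => by
    refine lt_of_pow_lt_pow_left₀ k (by linarith) (lt_of_le_of_lt ?_ h1)
    exact Finset.single_le_sum (f := fun j => h j ^ k) (fun j _ => pow_nonneg (hh j) k)
      (Finset.mem_univ i)
  have hlow : ∀ i, 1 - 3 / 2 * ε < h i := fun i => by
    have h3 : (h i + ε / 4)⁻¹ < (1 - 5 / 4 * ε)⁻¹ := by
      refine lt_of_pow_lt_pow_left₀ k (inv_nonneg.2 (by linarith)) (lt_of_le_of_lt ?_ h2)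
      exact Finset.single_le_sum (f := fun j => ((h j + ε / 4)⁻¹) ^ k)
        (fun j _ => pow_nonneg (inv_nonneg.2 (hpos j).le) k) (Finset.mem_univ i)
    have := (inv_lt_inv₀ (hpos i) (by linarith)).1 h3
    linarith
  have h4 : h a * h b ≤ (1 + ε) * (1 + ε) :=
    mul_le_mul (hup a).le (hup b).le (hh b) (by linarith)
  have h5 : (1 - 3 / 2 * ε) * (1 - 3 / 2 * ε) ≤ h a * h b :=
    mul_le_mul (hlow a).le (hlow b).le (by linarith) (hh a)
  rw [abs_le]
  constructor <;> nlinarith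

/-- Each of the two conditions defining `goodSet` fails with probability at most `δ / 2`. -/
theorem one_sub_le_measure_goodSet {U : Matrix (Fin d) (Fin r) ℝ} (hU : Uᵀ * U = 1) (hr : r ≠ 0)
    {ε δ : ℝ} (hε : 0 < ε) (hε' : ε ≤ 1 / 6) (hδ : 0 < δ) (hδ' : δ < 1)
    (hm : 3 * Real.log (2 * r / δ) ≤ ε ^ 2 * (m / (r + 1))) {k : ℕ}
    (hk : k = ⌈ε * (m / ((r : ℝ) + 1))⌉₊) :
    ENNReal.ofReal (1 - δ)
      ≤ (Measure.pi fun _ => gaussianReal 0 ((m : ℝ≥0)⁻¹)) (goodSet U m k ε) := by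
  set π : Measure (Fin d × Fin m → ℝ) := Measure.pi fun _ => gaussianReal 0 ((m : ℝ≥0)⁻¹)
  have hr1 : (1 : ℝ) ≤ r := by exact_mod_cast Nat.one_le_iff_ne_zero.2 hr
  have hratio : 2 ≤ 2 * r / δ := by
    rw [le_div_iff₀ hδ]; nlinarith
  have hL : 1 / 2 ≤ Real.log (2 * r / δ) := by
    have := Real.log_le_log two_pos hratio
    linarith [Real.log_two_gt_d9]
  have hexpL : Real.exp (Real.log (2 * r / δ)) = 2 * r / δ := Real.exp_log (by linarith)
  have hmul : ∀ y, r * Real.exp y = δ / 2 * Real.exp (Real.log (2 * r / δ) + y) := fun y => by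
    rw [Real.exp_add, hexpL]; field_simp
  have hm0 : m ≠ 0 := by
    rintro rfl
    simp at hm
    linarith
  obtain ⟨hb1, hb2, hb3⟩ := exponent_bounds hε hε' hL hm hk
  set L := Real.log (2 * r / δ)
  have hτ : 0 < ε / 4 := by linarith
  have hps := fun x : Fin d × Fin m → ℝ => compression_posSemidef U x
  have hup : π.real {x | (1 + ε) ^ k ≤ (compression U x ^ k).trace} ≤ δ / 2 := by
    have hM := mul_meas_ge_le_integral_of_nonneg (μ := π)
      (Filter.Eventually.of_forall fun x => trace_pow_nonneg (hps x) k)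
      (((MatPolyGrowth.compression U).pow k).trace.integrable _) ((1 + ε) ^ k)
    have hb : r * Real.exp (k * (k - 1) / (2 * (m / (r + 1)))) ≤ δ / 2 * (1 + ε) ^ k := by
      rw [hmul]
      gcongr
      calc _ ≤ Real.exp (12 / 13 * ε * k) := Real.exp_le_exp.2 hb2
        _ = Real.exp (12 / 13 * ε) ^ k := by rw [← Real.exp_nat_mul]; ring_nf
        _ ≤ _ := pow_le_pow_left₀ (Real.exp_pos _).le (exp_le_one_add hε hε') k
    have hM' := (hM.trans (integral_trace_compression_pow_le hU hm0 k)).trans hb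
    rw [mul_comm] at hM'
    exact le_of_mul_le_mul_right hM' (by positivity)
  have hlow : π.real {x | ((1 - 5 / 4 * ε)⁻¹) ^ k
      ≤ (resolvent (ε / 4) (compression U x) ^ k).trace} ≤ δ / 2 := by
    have hM := mul_meas_ge_le_integral_of_nonneg (μ := π)
      (Filter.Eventually.of_forall fun x => trace_resolvent_pow_nonneg (hps x) hτ k)
      (((MatPolyGrowth.resolvent U hτ).pow k).trace.integrable _) (((1 - 5 / 4 * ε)⁻¹) ^ k)
    have hb : r * Real.exp (5 / 4 * (k * (k + 1) / (2 * (m / (r + 1)))))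
        ≤ δ / 2 * ((1 - 5 / 4 * ε)⁻¹) ^ k := by
      rw [hmul]
      gcongr
      calc _ ≤ Real.exp (5 / 4 * ε * k) := Real.exp_le_exp.2 hb3
        _ = Real.exp (5 / 4 * ε) ^ k := by rw [← Real.exp_nat_mul]; ring_nf
        _ ≤ _ := pow_le_pow_left₀ (Real.exp_pos _).le (exp_le_inv_one_sub (by linarith)) k
    have hM' := (hM.trans (integral_trace_resolvent_pow_le hU hm0 hτ k hb1)).trans hb
    rw [mul_comm] at hM'
    have : 0 < 1 - 5 / 4 * ε := by linarith
    exact le_of_mul_le_mul_right hM' (by positivity)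
  have hcompl : π.real (goodSet U m k ε)ᶜ ≤ δ := by
    have hsub : (goodSet U m k ε)ᶜ ⊆ {x | (1 + ε) ^ k ≤ (compression U x ^ k).trace}
        ∪ {x | ((1 - 5 / 4 * ε)⁻¹) ^ k ≤ (resolvent (ε / 4) (compression U x) ^ k).trace} := by
      intro x hx
      by_contra hc
      simp only [Set.mem_union, Set.mem_ofPred_eq, not_or, not_le] at hc
      exact hx hc
    linarith [(measureReal_mono hsub).trans (measureReal_union_le (μ := π) _ _)]
  rw [probReal_compl_eq_one_sub (measurableSet_goodSet U k hε)] at hcompl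
  exact ENNReal.ofReal_le_of_le_toReal (by change 1 - δ ≤ π.real _; linarith)

end Tail

/-! ### The random projection event -/

/-- An orthonormal basis of a subspace of `ℝ^d`, as the columns of a matrix. -/
theorem exists_orthonormal_matrix {d r : ℕ} {W : Submodule ℝ (Fin d → ℝ)}
    (hr : Module.finrank ℝ W = r) :
    ∃ U : Matrix (Fin d) (Fin r) ℝ, Uᵀ * U = 1 ∧
      ∀ w ∈ W, (U * Uᵀ) *ᵥ w = w := by
  set e := (WithLp.linearEquiv 2 ℝ (Fin d → ℝ)).symm
  set W' : Submodule ℝ (EuclideanSpace ℝ (Fin d)) := W.map (e : (Fin d → ℝ) →ₗ[ℝ] _)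
  have hfr : Module.finrank ℝ W' = r := (LinearEquiv.finrank_map_eq e W).trans hr
  set B := (stdOrthonormalBasis ℝ W').reindex (finCongr hfr)
  refine ⟨Matrix.of fun a i => (B i : EuclideanSpace ℝ (Fin d)) a, ?_, fun w hw => ?_⟩
  · ext i j
    have h := orthonormal_iff_ite.1 B.orthonormal j i
    rw [Submodule.coe_inner, PiLp.inner_apply] at h
    simp only [Matrix.mul_apply, transpose_apply, of_apply, Matrix.one_apply]
    simp only [RCLike.inner_apply, conj_trivial] at h
    rw [h]
    simp only [eq_comm]
  · have hw' : e w ∈ W' := Submodule.mem_map_of_mem hw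
    have h := B.sum_repr' ⟨e w, hw'⟩
    have h2 := congrArg (fun y : W' => (y : EuclideanSpace ℝ (Fin d))) h
    ext a
    have h3 := congrArg (fun y : EuclideanSpace ℝ (Fin d) => y a) h2
    simp only [Submodule.coe_sum, Submodule.coe_smul, Submodule.coe_inner, PiLp.inner_apply,
      RCLike.inner_apply, conj_trivial, WithLp.ofLp_sum, Finset.sum_apply, PiLp.smul_apply,
      smul_eq_mul] at h3
    rw [← mulVec_mulVec]
    simp only [mulVec, dotProduct, transpose_apply, of_apply]
    refine Eq.trans ?_ h3
    refine Finset.sum_congr rfl fun i _ => ?_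
    rw [mul_comm]
    congr 1
    exact Finset.sum_congr rfl fun b _ => mul_comm _ _

/-- A Gaussian projection is only almost everywhere measurable, so the preimage of a measurable set
is replaced by a measurable subset of the same probability. -/
theorem IsGaussianProjection.exists_measurableSet {Ω : Type*} [MeasurableSpace Ω] {P : Measure Ω}
    [IsProbabilityMeasure P] {d m : ℕ} {R : Ω → Matrix (Fin d) (Fin m) ℝ}
    (hR : IsGaussianProjection P R) {S : Set (Fin d × Fin m → ℝ)} (hS : MeasurableSet S) :
    ∃ E : Set Ω, MeasurableSet E
      ∧ P E = (Measure.pi fun _ => gaussianReal 0 ((m : ℝ≥0)⁻¹)) S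
      ∧ ∀ ω ∈ E, (fun c => R ω c.1 c.2) ∈ S := by
  have hae : ∀ c : Fin d × Fin m, AEMeasurable (fun ω => R ω c.1 c.2) P :=
    fun c => (hR.1 c.1 c.2).aemeasurable
  have hmap := hR.2.map_fun_eq_pi_map hae
  simp only [(hR.1 _ _).map_eq] at hmap
  have hae' : AEMeasurable (fun ω (c : Fin d × Fin m) => R ω c.1 c.2) P :=
    aemeasurable_pi_lambda _ hae
  obtain ⟨E, hE, hEm, hEeq⟩ := (hae'.nullMeasurable hS).exists_measurable_subset_ae_eq
  refine ⟨E, hEm, ?_, fun ω hω => hE hω⟩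
  rw [measure_congr hEeq, ← Measure.map_apply_of_aemeasurable hae' hS, hmap]

theorem transpose_tripletMatrix {d : ℕ} (x y z : Fin d → ℝ) :
    (tripletMatrix x y z)ᵀ = tripletMatrix x y z := by
  simp [tripletMatrix]

theorem conj_tripletMatrix {d : ℕ} {Q : Matrix (Fin d) (Fin d) ℝ} (hQ : Qᵀ = Q) {x y z : Fin d → ℝ}
    (hx : Q *ᵥ x = x) (hy : Q *ᵥ y = y) (hz : Q *ᵥ z = z) :
    Q * tripletMatrix x y z * Q = tripletMatrix x y z := by
  have h : ∀ w, Q *ᵥ w = w → Q * vecMulVec w w * Q = vecMulVec w w := fun w hw => by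
    have hw' : w ᵥ* Q = w := by rw [← mulVec_transpose, hQ, hw]
    rw [mul_vecMulVec, hw, vecMulVec_mul, hw']
  rw [tripletMatrix, Matrix.mul_sub, Matrix.sub_mul, h _ (by rw [mulVec_sub, hx, hz]),
    h _ (by rw [mulVec_sub, hx, hy])]

end DualRP

theorem theorem1 :
    ∃ c : ℝ, 1 / 3 ≤ c ∧
      ∀ (d n N m r : ℕ) (x : Fin n → Fin d → ℝ) (i j k : Fin N → Fin n)
        (A : Fin N → Matrix (Fin d) (Fin d) ℝ)
        (_hA : ∀ t, A t = DualRP.tripletMatrix (x (i t)) (x (j t)) (x (k t)))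
        (ℓ : ℝ → ℝ) (_hℓ : ConvexOn ℝ Set.univ ℓ) (lam : ℝ) (_hlam : 0 < lam)
        (Mstar : Matrix (Fin d) (Fin d) ℝ) (_hM : DualRP.IsPrimalOptimal ℓ lam A Mstar)
        (_hr : ∃ V : Submodule ℝ (Fin d → ℝ), Module.finrank ℝ V = r ∧ ∀ a, x a ∈ V)
        (ε δ : ℝ) (_hε : 0 < ε) (_hε' : ε ≤ 1 / 6) (_hδ : 0 < δ) (_hδ' : δ < 1)
        (_hm : ((r : ℝ) + 1) * Real.log (2 * r / δ) / (c * ε ^ 2) ≤ m)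
        (Ω : Type*) [MeasurableSpace Ω] (P : Measure Ω) [IsProbabilityMeasure P]
        (R : Ω → Matrix (Fin d) (Fin m) ℝ) (_hR : DualRP.IsGaussianProjection P R),
        ∃ E : Set Ω, MeasurableSet E ∧ ENNReal.ofReal (1 - δ) ≤ P E ∧
          ∀ ω ∈ E, ∀ αhat : Fin N → ℝ,
            DualRP.IsDualOptimal ℓ lam (DualRP.gram (DualRP.projected (R ω) A)) αhat →
            ‖DualRP.psdProj Mstar - DualRP.psdProj (DualRP.recoveredMetric lam A αhat)‖
              ≤ 3 * ε / (1 - 3 * ε) * ‖Mstar‖ := by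
  refine ⟨1 / 3, le_rfl, ?_⟩
  intro d n N m r x i j k A hA ℓ hℓ lam hlam Mstar hM hr ε δ hε hε' hδ hδ' hm Ω _ P _ R hR
  obtain ⟨W, hWr, hW⟩ := hr
  obtain ⟨U, hU, hUW⟩ := DualRP.exists_orthonormal_matrix hWr
  have hAT : ∀ t, (A t)ᵀ = A t := fun t => by rw [hA, DualRP.transpose_tripletMatrix]
  have hUA : ∀ t, (U * Uᵀ) * A t * (U * Uᵀ) = A t := fun t => by
    rw [hA]
    exact DualRP.conj_tripletMatrix (by simp) (hUW _ (hW _)) (hUW _ (hW _)) (hUW _ (hW _))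
  -- the deterministic conclusion, for one value of the random matrix
  have hdet : ∀ (R₀ : Matrix (Fin d) (Fin m) ℝ) (V : Matrix (Fin r) (Fin r) ℝ) (h : Fin r → ℝ),
      Vᵀ * V = 1 → Uᵀ * R₀ * (Uᵀ * R₀)ᵀ = V * diagonal h * Vᵀ →
      (∀ a b, |1 - h a * h b| ≤ 3 * ε) → ∀ αhat : Fin N → ℝ,
        DualRP.IsDualOptimal ℓ lam (DualRP.gram (DualRP.projected R₀ A)) αhat →
        ‖DualRP.psdProj Mstar - DualRP.psdProj (DualRP.recoveredMetric lam A αhat)‖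
          ≤ 3 * ε / (1 - 3 * ε) * ‖Mstar‖ := by
    intro R₀ V h hV hH hh αhat hα
    have hVV := mul_eq_one_comm.1 hV
    refine (DualRP.norm_psdProj_sub_le _ _).trans ?_
    have hUV : U * V * (U * V)ᵀ = U * Uᵀ := by
      rw [transpose_mul, Matrix.mul_assoc, ← Matrix.mul_assoc V, hVV, Matrix.one_mul]
    refine DualRP.norm_sub_recoveredMetric_le hℓ hlam hAT hM R₀ (U * V) ?_ ?_ h ?_
      (by linarith) hh (by linarith) hα
    · rw [transpose_mul, Matrix.mul_assoc, ← Matrix.mul_assoc Uᵀ, hU, Matrix.one_mul, hV]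
    · rw [hUV]; exact hUA
    · calc (U * V)ᵀ * (R₀ * R₀ᵀ) * (U * V) = Vᵀ * (Uᵀ * R₀ * (Uᵀ * R₀)ᵀ) * V := by
            simp only [transpose_mul, transpose_transpose, Matrix.mul_assoc]
        _ = (Vᵀ * V) * diagonal h * (Vᵀ * V) := by
            rw [hH]; simp only [Matrix.mul_assoc]
        _ = diagonal h := by rw [hV, Matrix.one_mul, Matrix.mul_one]
  by_cases hr0 : r = 0
  · -- all data points vanish, and the eigenvalue condition is empty
    have : IsEmpty (Fin r) := by rw [hr0]; infer_instance
    refine ⟨Set.univ, MeasurableSet.univ, ?_, fun ω _ => hdet (R ω) 1 (fun _ => 1) (by simp)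
      (Subsingleton.elim _ _) fun a => this.elim a⟩
    rw [measure_univ, ENNReal.ofReal_le_one]
    linarith
  · have hm' : 3 * Real.log (2 * r / δ) ≤ ε ^ 2 * (m / (r + 1)) := by
      rw [div_le_iff₀ (by positivity)] at hm
      rw [← mul_div_assoc, le_div_iff₀ (by positivity)]
      linarith
    obtain ⟨E, hE, hPE, hgood⟩ := hR.exists_measurableSet
      (DualRP.measurableSet_goodSet U ⌈ε * (m / ((r : ℝ) + 1))⌉₊ hε)
    refine ⟨E, hE, ?_, fun ω hω => ?_⟩
    · rw [hPE]
      exact DualRP.one_sub_le_measure_goodSet hU hr0 hε hε' hδ hδ' hm' rfl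
    · obtain ⟨V, h, hV, hh, hH⟩ := DualRP.exists_orthogonal_diagonalization
        (DualRP.compression_posSemidef U fun c : Fin d × Fin m => R ω c.1 c.2)
      exact hdet (R ω) V h hV hH
        (DualRP.abs_one_sub_mul_le_of_mem_goodSet hε hε' (hgood ω hω) hV hh hH)
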